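/- Let $(\Omega,\mathcal F,\mu)$ be a measure space and let $(\mathcal F_i)_{i\in\mathbb Z}$ be a filtration of $\mathcal F$ such that $\mu$ restricted to $\mathcal F_i$ is $\sigma$-finite for every $i\in\mathbb Z$; let $\mathcal F_i^0$ be the collection of sets of finite measure in $\mathcal F_i$. For a function $f$ that is integrable over all sets in $\mathcal F_i^0$, let $\mathcal E_i f$ denote its conditional expectation with respect to $\mathcal F_i$, that is, the ($\mu$-a.e. unique) $\mathcal F_i$-measurable function, integrable over all $E\in\mathcal F_i^0$, with $\int_E \mathcal E_i f\,d\mu=\int_E f\,d\mu$ for all $E\in\mathcal F_i^0$. A weight is a nonnegative $\mathcal F$-measurable function that is integrable over every $E\in\mathcal F_i^0$, for every $i\in\mathbb Z$. Let $w$ be a weight, and let $\alpha=(\alpha_i)_{i\in\mathbb Z}$, where each $\alpha_i$ is a nonnegative bounded $\mathcal F_i$-measurable function, each $\overline\alpha_i:=\sum_{j\ge i}\alpha_j$ is a weight, and $$c^{-1}\,\overline\alpha_i\le \mathcal E_i\overline\alpha_i\le c\,\overline\alpha_i\quad \mu\text{-a.e., for all } i\in\mathbb Z, \tag{1.5}$$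 with a constant $c>0$ independent of $i$. Put $$T_\alpha f:=\sum_{i\in\mathbb Z}\alpha_i\,\mathcal E_i f .$$ Let $1<p<\infty$, $0<q<p$, $p'=\frac p{p-1}$, $\frac1r=\frac1q-\frac1p$, and let $$\mathcal W_\alpha[w]:=\sum_{i\in\mathbb Z}\alpha_i\,\overline\alpha_i^{\,p'-1}(\mathcal E_i w)^{p'-1}$$ be the discrete Wolff potential. Consider the following statements. (a) (Trace inequality with constant $C_1$.) For every $f\in L^p(d\mu)$ the series $T_\alpha f$ converges absolutely $w\,d\mu$-a.e., and $$\|T_\alpha f\|_{L^q(w\,d\mu)}\le C_1\|f\|_{L^p(d\mu)} .$$ (b) (Wolff potential bound with constant $C_2$.) $$\big\|\mathcal W_\alpha[w]^{1/p'}\big\|_{L^r(w\,d\mu)}\le C_2 .$$ There is a constant $C>0$, depending only on $p$, $q$ and the constant $c$ in (1.5), such that: 1. if $0<q<p<\infty$ and $1<p<\infty$, then (b) with a constant $C_2<\infty$ implies (a) with $C_1= C\,C_2$; 2. conversely, if $1<q<p<\infty$, then (a) with a constant $C_1<\infty$ implies (b) with $C_2= C\,C_1$. -/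

import Mathlib

open MeasureTheory
open scoped ENNReal NNReal

noncomputable section

/-- The conditional expectation `E[f | m]` of a real function `f` that is only required to be
integrable over the `m`-measurable sets of finite measure. It is the difference of the conditional
expectations (Mathlib's `condLExp`) of the positive and the negative part of `f`. -/
def condExpLoc {Ω : Type*} (m : MeasurableSpace Ω) {m₀ : MeasurableSpace Ω} (μ : Measure[m₀] Ω)
    (f : Ω → ℝ) (x : Ω) : ℝ :=
  (condLExp m μ (fun y => ENNReal.ofReal (f y)) x).toReal -
    (condLExp m μ (fun y => ENNReal.ofReal (-f y)) x).toReal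

/-- `condExpLoc m μ f` is `m`-measurable, integrable over the `m`-measurable sets of finite measure,
and has the same integral as `f` over each of them. -/
theorem condExpLoc_spec {Ω : Type*} {m m₀ : MeasurableSpace Ω} {μ : Measure Ω} (hm : m ≤ m₀)
    [SigmaFinite (μ.trim hm)] {f : Ω → ℝ}
    (hf : ∀ E, MeasurableSet[m] E → μ E < ∞ → IntegrableOn f E μ) :
    Measurable[m] (condExpLoc m μ f) ∧
      ∀ E, MeasurableSet[m] E → μ E < ∞ →
        IntegrableOn (condExpLoc m μ f) E μ ∧
          ∫ x in E, condExpLoc m μ f x ∂μ = ∫ x in E, f x ∂μ := by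
  refine ⟨?_, fun E hE hμE => ?_⟩
  · exact (measurable_condLExp m μ _).ennreal_toReal.sub
      (measurable_condLExp m μ _).ennreal_toReal
  · have hfE := hf E hE hμE
    have key : ∀ g : Ω → ℝ, IntegrableOn g E μ →
        IntegrableOn (fun x => (condLExp m μ (fun y => ENNReal.ofReal (g y)) x).toReal) E μ ∧
        ∫ x in E, (condLExp m μ (fun y => ENNReal.ofReal (g y)) x).toReal ∂μ =
          (∫⁻ x in E, ENNReal.ofReal (g x) ∂μ).toReal := by
      intro g hg
      have h1 := setLIntegral_condLExp hm μ (fun y => ENNReal.ofReal (g y)) hE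
      have hfin : ∫⁻ x in E, ENNReal.ofReal (g x) ∂μ ≠ ∞ := hg.lintegral_lt_top.ne
      have hmeas := measurable_condLExp' m μ (fun y => ENNReal.ofReal (g y))
      refine ⟨integrable_toReal_of_lintegral_ne_top hmeas.aemeasurable (by rw [h1]; exact hfin), ?_⟩
      rw [integral_toReal hmeas.aemeasurable
        (ae_lt_top hmeas (by rw [h1]; exact hfin)), h1]
    obtain ⟨i1, e1⟩ := key f hfE
    obtain ⟨i2, e2⟩ := key (fun x => -f x) hfE.neg
    refine ⟨i1.sub i2, ?_⟩
    unfold condExpLoc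
    rw [integral_sub i1 i2, e1, e2, integral_eq_lintegral_pos_part_sub_lintegral_neg_part hfE]

/-- A weight on the filtered measure space: a measurable nonnegative function that is integrable
over every set of finite measure of every `σ`-algebra of the filtration. (In a `σ`-finite filtered
measure space such a function is finite almost everywhere.) -/
def IsWeight {Ω : Type*} {m₀ : MeasurableSpace Ω} (ℱ : Filtration ℤ m₀) (μ : Measure Ω)
    (w : Ω → ℝ≥0∞) : Prop :=
  Measurable w ∧
    ∀ (i : ℤ) (E : Set Ω), MeasurableSet[ℱ i] E → μ E < ∞ → ∫⁻ x in E, w x ∂μ < ∞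

/-- The tail sums `ᾱ_i = ∑_{j ≥ i} α_j`. -/
def tailSum {Ω : Type*} (α : ℤ → Ω → ℝ≥0) (i : ℤ) (x : Ω) : ℝ≥0∞ :=
  ∑' j : Set.Ici i, (α j x : ℝ≥0∞)

/-- The condition on the coefficients: each `α_i` is a nonnegative bounded `ℱ_i`-measurable function,
each tail sum `ᾱ_i` is a weight, and `E[ᾱ_i | ℱ_i] ≈ ᾱ_i` with a comparison constant `c` that does
not depend on `i`. -/
structure TailCondition {Ω : Type*} {m₀ : MeasurableSpace Ω} (ℱ : Filtration ℤ m₀) (μ : Measure Ω)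
    (α : ℤ → Ω → ℝ≥0) (c : ℝ≥0) : Prop where
  measurable : ∀ i, Measurable[ℱ i] (α i)
  bounded : ∀ i, ∃ M : ℝ≥0, ∀ x, α i x ≤ M
  tail_isWeight : ∀ i, IsWeight ℱ μ (tailSum α i)
  condExp_le : ∀ i, ∀ᵐ x ∂μ, condLExp (ℱ i) μ (tailSum α i) x ≤ c * tailSum α i x
  le_condExp : ∀ i, ∀ᵐ x ∂μ, tailSum α i x ≤ c * condLExp (ℱ i) μ (tailSum α i) x

/-- The positive operator `T_α f = ∑_i α_i E[f | ℱ_i]`. -/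
def posOp {Ω : Type*} {m₀ : MeasurableSpace Ω} (ℱ : Filtration ℤ m₀) (μ : Measure Ω)
    (α : ℤ → Ω → ℝ≥0) (f : Ω → ℝ) (x : Ω) : ℝ :=
  ∑' i : ℤ, (α i x : ℝ) * condExpLoc (ℱ i) μ f x

/-- The trace inequality `‖T_α f‖_{L^q(w dμ)} ≤ C ‖f‖_{L^p(dμ)}` for all `f ∈ L^p(dμ)`, including
that the series that defines `T_α f` converges `w dμ`-almost everywhere. -/
def TraceInequality {Ω : Type*} {m₀ : MeasurableSpace Ω} (ℱ : Filtration ℤ m₀) (μ : Measure Ω)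
    (α : ℤ → Ω → ℝ≥0) (w : Ω → ℝ≥0∞) (p q : ℝ) (C : ℝ≥0) : Prop :=
  ∀ f : Ω → ℝ, MemLp f (ENNReal.ofReal p) μ →
    (∀ᵐ x ∂(μ.withDensity w), Summable fun i : ℤ => (α i x : ℝ) * condExpLoc (ℱ i) μ f x) ∧
      eLpNorm (posOp ℱ μ α f) (ENNReal.ofReal q) (μ.withDensity w) ≤
        C * eLpNorm f (ENNReal.ofReal p) μ

/-- The discrete Wolff potential `W_α[w] = ∑_i α_i ᾱ_i^{p'-1} (E[w | ℱ_i])^{p'-1}`, where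
`p' = p / (p - 1)`. -/
def wolffPotential {Ω : Type*} {m₀ : MeasurableSpace Ω} (ℱ : Filtration ℤ m₀) (μ : Measure Ω)
    (α : ℤ → Ω → ℝ≥0) (w : Ω → ℝ≥0∞) (p : ℝ) (x : Ω) : ℝ≥0∞ :=
  ∑' i : ℤ, (α i x : ℝ≥0∞) * tailSum α i x ^ (p.conjExponent - 1) *
    condLExp (ℱ i) μ w x ^ (p.conjExponent - 1)

/-- The Wolff potential bound `‖W_α[w]^{1/p'}‖_{L^r(w dμ)} ≤ C`. -/
def WolffBound {Ω : Type*} {m₀ : MeasurableSpace Ω} (ℱ : Filtration ℤ m₀) (μ : Measure Ω)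
    (α : ℤ → Ω → ℝ≥0) (w : Ω → ℝ≥0∞) (p r : ℝ) (C : ℝ≥0) : Prop :=
  eLpNorm (fun x => wolffPotential ℱ μ α w p x ^ (1 / p.conjExponent)) (ENNReal.ofReal r)
    (μ.withDensity w) ≤ C

end

/-!
The operator `T_α f = ∑_i α_i E_i f` is symmetric, so that for exponents `q > 1` the trace inequality
is equivalent to the bound `‖T_α (g w)‖_{L^{p'}(μ)} ≤ C ‖g‖_{L^{q'}(w)}` for its adjoint. The norm on
the left is computed by Wolff's inequality
`∫ (T_α f) ^ s dμ ≈ ∑_i ∫ α_i a_i ^ (s - 1) (E_i f) ^ s dμ`, where `s = p'` and `a_i = E_i ᾱ_i` is the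
adapted substitute of the tail sum `ᾱ_i`. It rests on one consequence of the tail condition: given
`ℱ_i`, the tail of the series `T_α f` from `i` on has conditional expectation comparable to `a_i E_i f`.
The lower bound (`tsum_lintegral_le_lintegral_posOpENN_rpow`) follows from Doob's maximal inequality, and
the upper bound (`lintegral_posOpENN_rpow_le`) from a moment inequality for sums with controlled
conditional tails (`lintegral_tsum_rpow_le`).

Put `W = ∑_i α_i a_i ^ (s - 1) (E_i w) ^ (s - 1)`, which is comparable to the Wolff potential, and write
`E_i (g w) = N_i E_i w`, where `N_i` is the conditional expectation of `g` for the measure `w dμ`. The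
right side of Wolff's inequality for `f = g w` is then at most `∫ W (sup_i N_i) ^ s w dμ`. Hölder's
inequality and Doob's inequality for `w dμ` give sufficiency for `q > 1`
(`lintegral_posOpENN_rpow_withDensity_le_of_one_lt`). Conversely, testing the adjoint bound on the power
`1 / s` of a maximal function of `h` bounds `∫ W h w dμ` by the norm of `h` in the dual of `L^{r / s}(w)`,
which is necessity (`lintegral_adaptedWolff_rpow_le`).

For `q ≤ 1` there is no duality. For all `q < p` at once, `w` is replaced by the damped weight `W ^ (-β) w`, whose
potential is at most a constant times `W ^ (1 - β / (p - 1))` (`adaptedWolff_damped_le`). With a suitable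
`β`, Hölder's inequality reduces the claim to the damped weight and an exponent `q₁` between `max 1 q`
and `p`, with the same norm of `W` on the right (`lintegral_posOpENN_rpow_withDensity_le`).
-/

open Filter Topology

/-! ### Power inequalities in `ℝ≥0∞`, truncation, and duality -/

lemma Real.rpow_le_rpow_add_mul_sub {S T m : ℝ} (hS : 0 ≤ S) (hT : 0 < T) (hm : 1 ≤ m) :
    T ^ m ≤ S ^ m + m * ((T - S) * T ^ (m - 1)) := by
  have hu : -1 ≤ S / T - 1 := by have := div_nonneg hS hT.le; linarith
  have h := one_add_mul_self_le_rpow_one_add hu hm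
  rw [add_sub_cancel, Real.div_rpow hS hT.le, le_div_iff₀ (by positivity)] at h
  rw [Real.rpow_sub_one hT.ne']
  have : (1 + m * (S / T - 1)) * T ^ m = T ^ m - m * ((T - S) * (T ^ m / T)) := by
    field_simp; ring
  linarith

lemma Real.rpow_add_mul_sub_le_rpow {S T m : ℝ} (hS : 0 ≤ S) (hT : 0 < T) (hm0 : 0 ≤ m)
    (hm : m ≤ 1) : S ^ m + m * ((T - S) * T ^ (m - 1)) ≤ T ^ m := by
  have hu : -1 ≤ S / T - 1 := by have := div_nonneg hS hT.le; linarith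
  have h := rpow_one_add_le_one_add_mul_self hu hm0 hm
  rw [add_sub_cancel, Real.div_rpow hS hT.le, div_le_iff₀ (by positivity)] at h
  rw [Real.rpow_sub_one hT.ne']
  have : (1 + m * (S / T - 1)) * T ^ m = T ^ m - m * ((T - S) * (T ^ m / T)) := by
    field_simp; ring
  linarith

namespace ENNReal

/-- A discrete form of `d(T ^ m) = m T ^ (m - 1) dT`, evaluated at the right endpoint. -/
lemma add_rpow_le_rpow_add_mul (S x : ℝ≥0∞) {m : ℝ} (hm : 1 ≤ m) :
    (S + x) ^ m ≤ S ^ m + ENNReal.ofReal m * (x * (S + x) ^ (m - 1)) := by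
  have hm0 : 0 < m := by linarith
  by_cases hS : S = ∞
  · simp [hS, hm0]
  by_cases hx : x = ∞
  · have : (∞ : ℝ≥0∞) ^ (m - 1) ≠ 0 := by simp [ENNReal.rpow_eq_zero_iff]; linarith
    simp [hx, ENNReal.top_mul this, ENNReal.mul_top, hm0]
  lift S to ℝ≥0 using hS
  lift x to ℝ≥0 using hx
  rcases eq_or_ne (S + x) 0 with h0 | h0
  · rw [← ENNReal.coe_add, h0]; simp [hm0]
  rw [← ENNReal.coe_add, ← ENNReal.coe_rpow_of_nonneg _ hm0.le,
    ← ENNReal.coe_rpow_of_nonneg _ hm0.le, ← ENNReal.coe_rpow_of_nonneg _ (by linarith),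
    ENNReal.ofReal, ← ENNReal.coe_mul, ← ENNReal.coe_mul, ← ENNReal.coe_add, ENNReal.coe_le_coe,
    ← NNReal.coe_le_coe]
  have := Real.rpow_le_rpow_add_mul_sub (S := S) (T := S + x) S.2
    (by exact_mod_cast pos_iff_ne_zero.2 h0) hm
  simpa [hm0.le] using this

/-- For `m ≤ 1` the derivative is decreasing, and the right endpoint gives a lower bound. -/
lemma rpow_add_mul_le_add_rpow (S x : ℝ≥0∞) {m : ℝ} (hm0 : 0 < m) (hm : m ≤ 1) :
    S ^ m + ENNReal.ofReal m * (x * (S + x) ^ (m - 1)) ≤ (S + x) ^ m := by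
  by_cases hS : S = ∞
  · simp [hS, hm0]
  by_cases hx : x = ∞
  · simp [hx, hm0]
  lift S to ℝ≥0 using hS
  lift x to ℝ≥0 using hx
  rcases eq_or_ne (S + x) 0 with h0 | h0
  · obtain ⟨h1, h2⟩ := add_eq_zero.1 h0
    simp [h1, h2, hm0]
  rw [← ENNReal.coe_add, ← ENNReal.coe_rpow_of_nonneg _ hm0.le,
    ← ENNReal.coe_rpow_of_nonneg _ hm0.le, ← ENNReal.coe_rpow_of_ne_zero h0,
    ENNReal.ofReal, ← ENNReal.coe_mul, ← ENNReal.coe_mul, ← ENNReal.coe_add, ENNReal.coe_le_coe,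
    ← NNReal.coe_le_coe]
  have := Real.rpow_add_mul_sub_le_rpow (S := S) (T := S + x) S.2
    (by exact_mod_cast pos_iff_ne_zero.2 h0) hm0.le hm
  simpa [hm0.le] using this

lemma sum_rpow_le_sum_mul_partial (y : ℕ → ℝ≥0∞) {m : ℝ} (hm : 1 ≤ m) (n : ℕ) :
    (∑ k ∈ Finset.range n, y k) ^ m ≤ ENNReal.ofReal m *
      ∑ k ∈ Finset.range n, y k * (∑ j ∈ Finset.range (k + 1), y j) ^ (m - 1) := by
  induction n with
  | zero => simp [show 0 < m by linarith]
  | succ n ih =>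
    rw [Finset.sum_range_succ, Finset.sum_range_succ (fun k => y k * _), mul_add]
    refine (add_rpow_le_rpow_add_mul _ _ hm).trans (add_le_add ih ?_)
    rw [← Finset.sum_range_succ]

lemma sum_rpow_le_sum_mul_tail (y : ℕ → ℝ≥0∞) {m : ℝ} (hm : 1 ≤ m) (n : ℕ) :
    (∑ k ∈ Finset.range n, y k) ^ m ≤ ENNReal.ofReal m *
      ∑ k ∈ Finset.range n, y k * (∑ j ∈ Finset.range (n - k), y (k + j)) ^ (m - 1) := by
  induction n generalizing y with
  | zero => simp [show 0 < m by linarith]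
  | succ n ih =>
    rw [Finset.sum_range_succ', Finset.sum_range_succ' (fun k => y k * _), mul_add]
    refine (add_rpow_le_rpow_add_mul _ _ hm).trans (add_le_add ?_ ?_)
    · refine (ih fun k => y (k + 1)).trans (le_of_eq ?_)
      simp only [Nat.add_sub_add_right]
      congr 1
      refine Finset.sum_congr rfl fun k _ => ?_
      congr 3
      ext j
      congr 1
      ring
    · simp [Finset.sum_range_succ']

lemma sum_mul_partial_le_sum_rpow (y : ℕ → ℝ≥0∞) {m : ℝ} (hm0 : 0 < m) (hm : m ≤ 1) (n : ℕ) :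
    ENNReal.ofReal m *
      ∑ k ∈ Finset.range n, y k * (∑ j ∈ Finset.range (k + 1), y j) ^ (m - 1) ≤
      (∑ k ∈ Finset.range n, y k) ^ m := by
  induction n with
  | zero => simp
  | succ n ih =>
    rw [Finset.sum_range_succ, Finset.sum_range_succ (fun k => y k), mul_add]
    refine le_trans (add_le_add ih ?_) (rpow_add_mul_le_add_rpow _ _ hm0 hm)
    rw [← Finset.sum_range_succ]

/-- The absorption step after an application of Hölder's inequality. -/
lemma le_rpow_of_le_mul_rpow {s s' : ℝ} (h : s.HolderConjugate s') {I K : ℝ≥0∞} (hI : I ≠ ∞)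
    (hIK : I ≤ K * I ^ (1 / s')) : I ≤ K ^ s := by
  rcases eq_or_ne I 0 with h0 | h0
  · simp [h0]
  have h1 : I ^ (1 / s) ≤ K := by
    have e : I = I ^ (1 / s) * I ^ (1 / s') := by
      rw [← ENNReal.rpow_add _ _ h0 hI]
      simp [h.inv_add_inv_eq_one]
    have : I ^ (1 / s') ≠ 0 := by simp [ENNReal.rpow_eq_zero_iff, h0, hI]
    have h' : I ^ (1 / s') ≠ ∞ := by simp [ENNReal.rpow_eq_top_iff, h0, hI]
    replace hIK := e.symm.le.trans hIK
    exact (ENNReal.mul_le_mul_iff_left this h').1 hIK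
  calc I = (I ^ (1 / s)) ^ s := by
        rw [← ENNReal.rpow_mul, one_div_mul_cancel h.ne_zero, ENNReal.rpow_one]
    _ ≤ K ^ s := ENNReal.rpow_le_rpow h1 h.nonneg

lemma tendsto_tsum_int_shift (y : ℤ → ℝ≥0∞) :
    Tendsto (fun m : ℕ => ∑' n : ℕ, y (-m + n)) atTop (𝓝 (∑' i, y i)) := by
  have inj : ∀ m : ℕ, Function.Injective fun n : ℕ => (-m + n : ℤ) := fun m a b h => by
    simpa using h
  refine tendsto_order.2 ⟨fun a ha => ?_, fun a ha => Eventually.of_forall fun m => ?_⟩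
  · rw [ENNReal.tsum_eq_iSup_sum, lt_iSup_iff] at ha
    obtain ⟨t, ht⟩ := ha
    obtain ⟨M, hM⟩ := t.bddBelow
    filter_upwards [eventually_ge_atTop M.natAbs] with m hm
    refine ht.trans_le ?_
    have h0 : ∀ i ∈ t, 0 ≤ i + m := fun i hi => by have := hM hi; omega
    have e : ∑ i ∈ t, y i = ∑ n ∈ t.image fun i : ℤ => (i + m).toNat, y (-m + n) := by
      rw [Finset.sum_image fun i hi j hj hij => by
        have h1 := h0 i hi
        have h2 := h0 j hj
        have h3 : (i + m).toNat = (j + m).toNat := hij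
        omega]
      refine Finset.sum_congr rfl fun i hi => ?_
      rw [Int.toNat_of_nonneg (h0 i hi)]
      congr 1
      ring
    rw [e]
    exact ENNReal.sum_le_tsum _
  · exact (ENNReal.tsum_comp_le_tsum_of_injective (inj m) y).trans_lt ha

end ENNReal

lemma lintegral_le_of_tendsto_of_le {Ω : Type*} {m₀ : MeasurableSpace Ω} {μ : Measure Ω}
    {F : ℕ → Ω → ℝ≥0∞} {f : Ω → ℝ≥0∞} {K : ℝ≥0∞} (hF : ∀ l, Measurable (F l))
    (h : ∀ x, Tendsto (fun l => F l x) atTop (𝓝 (f x))) (hK : ∀ l, ∫⁻ x, F l x ∂μ ≤ K) :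
    ∫⁻ x, f x ∂μ ≤ K :=
  calc ∫⁻ x, f x ∂μ = ∫⁻ x, liminf (fun l => F l x) atTop ∂μ := by
        simp_rw [fun x => (h x).liminf_eq]
    _ ≤ liminf (fun l => ∫⁻ x, F l x ∂μ) atTop := lintegral_liminf_le hF
    _ ≤ K := liminf_le_of_le (h := fun b hb => by
        obtain ⟨l, hl⟩ := hb.exists; exact hl.trans (hK l))

/-- The truncation of a function to a set and to the height `l`. -/
noncomputable def truncate {Ω : Type*} (A : Set Ω) (l : ℕ) (F : Ω → ℝ≥0∞) : Ω → ℝ≥0∞ :=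
  A.indicator fun x => min (F x) l

section truncate
variable {Ω : Type*} {A : Set Ω} {l : ℕ} {F : Ω → ℝ≥0∞}

lemma truncate_le (A : Set Ω) (l : ℕ) (F : Ω → ℝ≥0∞) (x : Ω) : truncate A l F x ≤ F x :=
  (Set.indicator_le_self' (fun _ _ => zero_le) x).trans (min_le_left _ _)

lemma truncate_le_indicator (A : Set Ω) (l : ℕ) (F : Ω → ℝ≥0∞) (x : Ω) :
    truncate A l F x ≤ A.indicator (fun _ => (l : ℝ≥0∞)) x :=
  Set.indicator_le_indicator (min_le_right _ _)

lemma measurable_truncate {m : MeasurableSpace Ω} (hA : MeasurableSet A) (hF : Measurable F) :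
    Measurable (truncate A l F) := (hF.min measurable_const).indicator hA

lemma tendsto_truncate {A : ℕ → Set Ω} (hA : Monotone A) (hU : ⋃ l, A l = Set.univ)
    (F : Ω → ℝ≥0∞) (x : Ω) : Tendsto (fun l => truncate (A l) l F x) atTop (𝓝 (F x)) := by
  obtain ⟨N, hN⟩ := Set.mem_iUnion.1 (hU ▸ Set.mem_univ x)
  have h : Tendsto (fun l : ℕ => min (F x) l) atTop (𝓝 (min (F x) ∞)) :=
    tendsto_const_nhds.min ENNReal.tendsto_nat_nhds_top
  rw [min_eq_left le_top] at h
  refine h.congr' ?_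
  filter_upwards [eventually_ge_atTop N] with l hl
  rw [truncate, Set.indicator_of_mem (hA hl hN)]

end truncate

/-- The converse of Hölder's inequality: a function is in `L^s` if it pairs boundedly with the functions
of finite `L^s'` norm. -/
lemma lintegral_rpow_le_of_forall_dual {Ω : Type*} {m₀ : MeasurableSpace Ω} {ν : Measure Ω}
    [SigmaFinite ν] {s s' : ℝ} (h : s.HolderConjugate s') {F : Ω → ℝ≥0∞} (hF : Measurable F)
    {K : ℝ≥0∞} (hK : ∀ g : Ω → ℝ≥0∞, Measurable g → ∫⁻ x, g x ^ s' ∂ν ≠ ∞ →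
      ∫⁻ x, F x * g x ∂ν ≤ K * (∫⁻ x, g x ^ s' ∂ν) ^ (1 / s')) :
    ∫⁻ x, F x ^ s ∂ν ≤ K ^ s := by
  have hA := measurableSet_spanningSets ν
  have hG : ∀ l, Measurable (truncate (spanningSets ν l) l F) := fun l =>
    measurable_truncate (hA l) hF
  refine lintegral_le_of_tendsto_of_le (F := fun l x => truncate (spanningSets ν l) l F x ^ s)
    (fun l => (hG l).pow_const _)
    (fun x => ((ENNReal.continuous_rpow_const).tendsto _).comp (tendsto_truncate
      (monotone_spanningSets ν) (iUnion_spanningSets ν) F x)) fun l => ?_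
  set G := truncate (spanningSets ν l) l F with hGdef
  have hs1 : 0 < s - 1 := h.sub_one_pos
  have e : ∀ x, (G x ^ (s - 1)) ^ s' = G x ^ s := fun x => by
    rw [← ENNReal.rpow_mul, h.sub_one_mul_conj]
  have hfin : ∫⁻ x, G x ^ s ∂ν ≠ ∞ := by
    refine ne_of_lt (lt_of_le_of_lt (lintegral_mono (g := (spanningSets ν l).indicator
      fun _ => (l : ℝ≥0∞) ^ s) fun x => ?_) ?_)
    · refine (ENNReal.rpow_le_rpow (truncate_le_indicator _ _ _ x) h.nonneg).trans ?_
      by_cases hx : x ∈ spanningSets ν l <;> simp [hx, h.pos]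
    · rw [lintegral_indicator (hA l), setLIntegral_const]
      exact ENNReal.mul_lt_top (ENNReal.rpow_lt_top_of_nonneg h.nonneg (by simp))
        (measure_spanningSets_lt_top ν l)
  have key := hK (fun x => G x ^ (s - 1)) ((hG l).pow_const _) (by simp_rw [e]; exact hfin)
  simp_rw [e] at key
  refine ENNReal.le_rpow_of_le_mul_rpow h hfin (le_trans (lintegral_mono fun x => ?_) key)
  calc G x ^ s = G x ^ (1 + (s - 1)) := by ring_nf
    _ = G x * G x ^ (s - 1) := by
      rw [ENNReal.rpow_add_of_nonneg _ _ zero_le_one hs1.le, ENNReal.rpow_one]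
    _ ≤ F x * G x ^ (s - 1) := by gcongr; exact truncate_le _ _ _ x

/-! ### Doob's maximal inequality -/

lemma measurable_finset_range_sup {Ω : Type*} {m : MeasurableSpace Ω} {N : ℕ → Ω → ℝ≥0∞} {n : ℕ}
    (hN : ∀ k < n, Measurable (N k)) :
    Measurable fun x => (Finset.range n).sup fun k => N k x := by
  induction n with
  | zero => simp
  | succ n ih =>
    simp only [Finset.range_add_one, Finset.sup_insert]
    exact (hN n (by omega)).sup (ih fun k hk => hN k (by omega))

/-- The discrete form of `d(M ^ t) = t' M d(M ^ (t - 1))` for a running maximum `M`: at the times where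
`M` increases it equals `N k`. -/
lemma rpow_sup_le_sum_mul_sub (N : ℕ → ℝ≥0∞) {t t' : ℝ} (h : t.HolderConjugate t') (n : ℕ) :
    ((Finset.range n).sup N) ^ t ≤ ENNReal.ofReal t' * ∑ k ∈ Finset.range n, N k *
      (((Finset.range (k + 1)).sup N) ^ (t - 1) - ((Finset.range k).sup N) ^ (t - 1)) := by
  induction n with
  | zero => simp [h.pos]
  | succ n ih =>
    rw [Finset.sum_range_succ, mul_add]
    set M := (Finset.range n).sup N
    have hM : (Finset.range (n + 1)).sup N = N n ⊔ M := by
      rw [Finset.range_add_one, Finset.sup_insert]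
    rw [hM]
    rcases le_total (N n) M with hle | hle
    · rw [sup_eq_right.2 hle]; exact ih.trans le_self_add
    rw [sup_eq_left.2 hle]
    have hmono : M ^ (t - 1) ≤ N n ^ (t - 1) := ENNReal.rpow_le_rpow hle h.sub_one_pos.le
    have key := ENNReal.add_rpow_le_rpow_add_mul (M ^ (t - 1)) (N n ^ (t - 1) - M ^ (t - 1))
      h.symm.lt.le
    have e : (t - 1) * (t' - 1) = 1 := by
      have := h.sub_one_mul_conj; have := h.symm.sub_one_mul_conj; nlinarith
    rw [add_tsub_cancel_of_le hmono, ← ENNReal.rpow_mul, ← ENNReal.rpow_mul, ← ENNReal.rpow_mul,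
      h.sub_one_mul_conj, e, ENNReal.rpow_one, mul_comm (_ - _)] at key
    exact key.trans (add_le_add_left ih _)

/-- **Doob's maximal inequality**, for an adapted sequence whose conditional expectations are only known
through the integrals `∫ φ N_k ≤ ∫ φ g`. The sequence need not be a martingale. -/
theorem lintegral_iSup_rpow_le {Ω : Type*} {m₀ : MeasurableSpace Ω} {ν : Measure Ω}
    {𝒢 : Filtration ℕ m₀} [SigmaFinite (ν.trim (𝒢.le 0))] {t t' : ℝ} (h : t.HolderConjugate t')
    {N : ℕ → Ω → ℝ≥0∞} {g : Ω → ℝ≥0∞} (hN : ∀ k, Measurable[𝒢 k] (N k)) (hg : Measurable g)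
    (hNg : ∀ k φ, Measurable[𝒢 k] φ → ∫⁻ x, φ x * N k x ∂ν ≤ ∫⁻ x, φ x * g x ∂ν) :
    ∫⁻ x, (⨆ k, N k x) ^ t ∂ν ≤ ENNReal.ofReal t' ^ t * ∫⁻ x, g x ^ t ∂ν := by
  set A := spanningSets (ν.trim (𝒢.le 0)) with hAdef
  have hA0 : ∀ l, MeasurableSet[𝒢 0] (A l) := fun l =>
    @measurableSet_spanningSets _ (𝒢 0) (ν.trim (𝒢.le 0)) _ l
  have hA : ∀ l k, MeasurableSet[𝒢 k] (A l) := fun l k => 𝒢.mono (Nat.zero_le k) _ (hA0 l)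
  have hAfin : ∀ l, ν (A l) < ∞ := fun l => by
    rw [← trim_measurableSet_eq (𝒢.le 0) (hA0 l)]; exact measure_spanningSets_lt_top _ l
  have hAmono : Monotone A := monotone_spanningSets _
  have hAun : ⋃ l, A l = Set.univ := iUnion_spanningSets _
  have hN0 : ∀ k, Measurable (N k) := fun k => (hN k).mono (𝒢.le k) le_rfl
  -- the maximal function of finitely many truncated terms
  have trunc : ∀ n l, ∫⁻ x, ((Finset.range n).sup fun k => truncate (A l) l (N k) x) ^ t ∂ν ≤
      ENNReal.ofReal t' ^ t * ∫⁻ x, g x ^ t ∂ν := by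
    intro n l
    set N' : ℕ → Ω → ℝ≥0∞ := fun k => truncate (A l) l (N k) with hN'
    have hN'm : ∀ k, Measurable[𝒢 k] (N' k) := fun k => measurable_truncate (hA l k) (hN k)
    set M : ℕ → Ω → ℝ≥0∞ := fun n x => (Finset.range n).sup fun k => N' k x with hM
    have hMm : ∀ k, Measurable (M k) := fun k =>
      measurable_finset_range_sup fun j _ => (hN'm j).mono (𝒢.le j) le_rfl
    have hΔm : ∀ k, Measurable[𝒢 k] fun x => M (k + 1) x ^ (t - 1) - M k x ^ (t - 1) := fun k =>
      ((measurable_finset_range_sup fun j hj => (hN'm j).mono (𝒢.mono (by omega)) le_rfl).pow_const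
        _).sub ((measurable_finset_range_sup fun j hj =>
          (hN'm j).mono (𝒢.mono (by omega)) le_rfl).pow_const _)
    have hMmono : ∀ k x, M k x ≤ M (k + 1) x := fun k x =>
      Finset.sup_mono (Finset.range_mono (Nat.le_succ k))
    have tel : ∀ x, ∑ k ∈ Finset.range n, (M (k + 1) x ^ (t - 1) - M k x ^ (t - 1)) =
        M n x ^ (t - 1) := by
      intro x
      induction n with
      | zero => simp [hM, h.sub_one_pos]
      | succ n ih =>
        rw [Finset.sum_range_succ, ih, add_tsub_cancel_of_le
          (ENNReal.rpow_le_rpow (hMmono n x) h.sub_one_pos.le)]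
    have step : ∀ k, ∫⁻ x, N' k x * (M (k + 1) x ^ (t - 1) - M k x ^ (t - 1)) ∂ν ≤
        ∫⁻ x, g x * (M (k + 1) x ^ (t - 1) - M k x ^ (t - 1)) ∂ν := fun k =>
      calc _ ≤ ∫⁻ x, (M (k + 1) x ^ (t - 1) - M k x ^ (t - 1)) * N k x ∂ν :=
            lintegral_mono fun x => by
              rw [mul_comm]; gcongr; exact truncate_le _ _ _ x
        _ ≤ _ := (hNg k _ (hΔm k)).trans_eq (by simp_rw [mul_comm])
    have fin : ∫⁻ x, M n x ^ t ∂ν ≠ ∞ := by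
      refine ne_of_lt (lt_of_le_of_lt (lintegral_mono (g := (A l).indicator
        fun _ => (l : ℝ≥0∞) ^ t) fun x => ?_) ?_)
      · refine (ENNReal.rpow_le_rpow (Finset.sup_le fun k _ =>
          truncate_le_indicator (A l) l (N k) x) h.nonneg).trans ?_
        by_cases hx : x ∈ A l <;> simp [hx, h.pos]
      · rw [lintegral_indicator (𝒢.le 0 _ (hA0 l)), setLIntegral_const]
        exact ENNReal.mul_lt_top (ENNReal.rpow_lt_top_of_nonneg h.nonneg (by simp)) (hAfin l)
    have main : ∫⁻ x, M n x ^ t ∂ν ≤ (ENNReal.ofReal t' * (∫⁻ x, g x ^ t ∂ν) ^ (1 / t)) *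
        (∫⁻ x, M n x ^ t ∂ν) ^ (1 / t') :=
      calc ∫⁻ x, M n x ^ t ∂ν
          ≤ ∫⁻ x, ENNReal.ofReal t' * ∑ k ∈ Finset.range n,
              N' k x * (M (k + 1) x ^ (t - 1) - M k x ^ (t - 1)) ∂ν :=
            lintegral_mono fun x => rpow_sup_le_sum_mul_sub (fun k => N' k x) h n
        _ = ENNReal.ofReal t' * ∑ k ∈ Finset.range n,
              ∫⁻ x, N' k x * (M (k + 1) x ^ (t - 1) - M k x ^ (t - 1)) ∂ν := by
            have hm : ∀ k, Measurable fun x =>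
                N' k x * (M (k + 1) x ^ (t - 1) - M k x ^ (t - 1)) := fun k =>
              ((hN'm k).mul (hΔm k)).mono (𝒢.le k) le_rfl
            rw [lintegral_const_mul _ (Finset.measurable_sum _ fun k _ => hm k),
              lintegral_finsetSum _ fun k _ => hm k]
        _ ≤ ENNReal.ofReal t' * ∑ k ∈ Finset.range n,
              ∫⁻ x, g x * (M (k + 1) x ^ (t - 1) - M k x ^ (t - 1)) ∂ν := by
            gcongr ENNReal.ofReal t' * ?_
            exact Finset.sum_le_sum fun k _ => step k
        _ = ENNReal.ofReal t' * ∫⁻ x, g x * M n x ^ (t - 1) ∂ν := by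
            rw [← lintegral_finsetSum (f := fun k x =>
              g x * (M (k + 1) x ^ (t - 1) - M k x ^ (t - 1))) _
              fun k _ => hg.mul ((hΔm k).mono (𝒢.le k) le_rfl)]
            simp_rw [← Finset.mul_sum, tel]
        _ ≤ ENNReal.ofReal t' * ((∫⁻ x, g x ^ t ∂ν) ^ (1 / t) *
              (∫⁻ x, (M n x ^ (t - 1)) ^ t' ∂ν) ^ (1 / t')) := by
            gcongr
            exact ENNReal.lintegral_mul_le_Lp_mul_Lq ν h hg.aemeasurable
              ((hMm n).pow_const _).aemeasurable
        _ = _ := by simp_rw [← ENNReal.rpow_mul, h.sub_one_mul_conj, mul_assoc]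
    refine (ENNReal.le_rpow_of_le_mul_rpow h fin main).trans_eq ?_
    rw [ENNReal.mul_rpow_of_nonneg _ _ h.nonneg, ← ENNReal.rpow_mul, one_div_mul_cancel h.ne_zero,
      ENNReal.rpow_one]
  have hcont := fun y => (ENNReal.continuous_rpow_const (y := t)).tendsto y
  have finite : ∀ n, ∫⁻ x, ((Finset.range n).sup fun k => N k x) ^ t ∂ν ≤
      ENNReal.ofReal t' ^ t * ∫⁻ x, g x ^ t ∂ν := fun n =>
    lintegral_le_of_tendsto_of_le
      (F := fun l x => ((Finset.range n).sup fun k => truncate (A l) l (N k) x) ^ t)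
      (fun l => (measurable_finset_range_sup fun k _ =>
        measurable_truncate (𝒢.le 0 _ (hA0 l)) (hN0 k)).pow_const _)
      (fun x => (hcont _).comp (Tendsto.finset_sup_nhds_apply fun k _ =>
        tendsto_truncate hAmono hAun (N k) x)) fun l => trunc n l
  refine lintegral_le_of_tendsto_of_le (F := fun n x => ((Finset.range n).sup fun k => N k x) ^ t)
    (fun n => (measurable_finset_range_sup fun k _ => hN0 k).pow_const _)
    (fun x => (hcont _).comp ?_) finite
  have hmono : Monotone fun n => (Finset.range n).sup fun k => N k x := fun a b hab =>
    Finset.sup_mono (Finset.range_mono hab)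
  convert tendsto_atTop_iSup hmono using 2
  refine le_antisymm (iSup_le fun k => ?_) (iSup_le fun n => Finset.sup_le fun k _ =>
    le_iSup (fun k => N k x) k)
  exact le_iSup_of_le (k + 1) (Finset.le_sup (f := fun k => N k x) (Finset.self_mem_range_succ k))

/-! ### A moment inequality for sums with controlled conditional tails -/

namespace ENNReal

lemma rpow_sub_two_mul_self_le (b : ℝ≥0∞) {s : ℝ} (hs : 1 < s) :
    b ^ (s - 2) * b ≤ b ^ (s - 1) := by
  rcases eq_or_ne b 0 with rfl | h0
  · simp
  rcases eq_or_ne b ∞ with rfl | hb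
  · rw [ENNReal.top_rpow_of_pos (by linarith : 0 < s - 1)]; exact le_top
  refine le_of_eq ?_
  nth_rw 2 [← ENNReal.rpow_one b]
  rw [← ENNReal.rpow_add _ _ h0 hb]
  ring_nf

/-- The power `T ^ (s - 1)` lies below a function that is affine in `T`. At `b = 0` the term
`b ^ (s - 2)` may be infinite, which is harmless since then `y = 0`. -/
lemma mul_rpow_sub_one_le_of_le_two {y b : ℝ≥0∞} (hyb : y ≤ b) (T : ℝ≥0∞) {s : ℝ} (hs : 1 < s)
    (hs2 : s ≤ 2) : y * T ^ (s - 1) ≤ y * b ^ (s - 1) + y * b ^ (s - 2) * T := by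
  rcases le_or_gt T b with h | h
  · exact le_add_right (by gcongr)
  refine le_add_left ?_
  rcases eq_or_ne y 0 with rfl | hy
  · simp
  have hb0 : b ≠ 0 := fun h0 => hy (le_antisymm (h0 ▸ hyb) zero_le)
  have hb : b ≠ ∞ := h.ne_top
  rw [mul_assoc]
  gcongr
  rcases eq_or_ne T ∞ with rfl | hT
  · rw [ENNReal.mul_top (by simp [ENNReal.rpow_eq_zero_iff, hb0, hb])]; exact le_top
  calc T ^ (s - 1) = T ^ (s - 2) * T := by
        nth_rw 3 [← ENNReal.rpow_one T]
        rw [← ENNReal.rpow_add _ _ (pos_of_gt h).ne' hT]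
        ring_nf
    _ ≤ b ^ (s - 2) * T := by
        gcongr ?_ * T
        rw [show s - 2 = -(2 - s) by ring, ENNReal.rpow_neg, ENNReal.rpow_neg]
        exact ENNReal.inv_le_inv.2 (ENNReal.rpow_le_rpow h.le (by linarith))

lemma mul_rpow_sub_two_le (b S : ℝ≥0∞) {D : ℝ≥0∞} (hD0 : D ≠ 0) (hD : D ≠ ∞) {s : ℝ}
    (hs2 : 2 ≤ s) : b * S ^ (s - 2) ≤ D ^ (s - 2) * b ^ (s - 1) + D⁻¹ * S ^ (s - 1) := by
  have e : ∀ x : ℝ≥0∞, x * x ^ (s - 2) = x ^ (s - 1) := fun x => by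
    rw [show s - 1 = 1 + (s - 2) by ring,
      ENNReal.rpow_add_of_nonneg _ _ zero_le_one (by linarith), ENNReal.rpow_one]
  rcases le_total S (D * b) with h | h
  · refine le_add_right ?_
    calc b * S ^ (s - 2) ≤ b * (D * b) ^ (s - 2) := by gcongr
      _ = D ^ (s - 2) * b ^ (s - 1) := by
        rw [ENNReal.mul_rpow_of_nonneg _ _ (by linarith), mul_left_comm, e]
  · refine le_add_left ?_
    have : b ≤ D⁻¹ * S := by
      rw [mul_comm, ← div_eq_mul_inv, ENNReal.le_div_iff_mul_le (.inl hD0) (.inl hD), mul_comm]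
      exact h
    calc b * S ^ (s - 2) ≤ D⁻¹ * S * S ^ (s - 2) := by gcongr
      _ = D⁻¹ * S ^ (s - 1) := by rw [mul_assoc, e]

lemma sum_rpow_le_sum_mul_partial_mul_tail (y : ℕ → ℝ≥0∞) {s : ℝ} (hs2 : 2 ≤ s) (n : ℕ) :
    (∑ k ∈ Finset.range n, y k) ^ s ≤ ENNReal.ofReal (s * (s - 1)) * ∑ k ∈ Finset.range n,
      y k * (∑ j ∈ Finset.range (k + 1), y j) ^ (s - 2) *
        ∑ j ∈ Finset.range (n - k), y (k + j) := by
  have h1 := sum_rpow_le_sum_mul_partial y (by linarith : 1 ≤ s) n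
  refine h1.trans ?_
  rw [ENNReal.ofReal_mul (by linarith), mul_assoc]
  gcongr
  calc ∑ k ∈ Finset.range n, y k * (∑ j ∈ Finset.range (k + 1), y j) ^ (s - 1)
      ≤ ∑ k ∈ Finset.range n, y k * (ENNReal.ofReal (s - 1) *
          ∑ i ∈ Finset.range (k + 1), y i * (∑ j ∈ Finset.range (i + 1), y j) ^ (s - 2)) := by
        gcongr with k _
        have := sum_rpow_le_sum_mul_partial y (by linarith : 1 ≤ s - 1) (k + 1)
        rwa [show s - 1 - 1 = s - 2 by ring] at this
    _ = ENNReal.ofReal (s - 1) * ∑ k ∈ Finset.range n, ∑ i ∈ Finset.range (k + 1),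
          y k * (y i * (∑ j ∈ Finset.range (i + 1), y j) ^ (s - 2)) := by
        simp_rw [Finset.mul_sum]
        refine Finset.sum_congr rfl fun k _ => Finset.sum_congr rfl fun i _ => ?_
        ring
    _ = ENNReal.ofReal (s - 1) * ∑ i ∈ Finset.range n, ∑ k ∈ Finset.Ico i n,
          y k * (y i * (∑ j ∈ Finset.range (i + 1), y j) ^ (s - 2)) := by
        congr 1
        refine Finset.sum_comm' fun k i => ?_
        simp only [Finset.mem_range, Finset.mem_Ico]
        omega
    _ = _ := by
        congr 1
        refine Finset.sum_congr rfl fun i _ => ?_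
        rw [← Finset.sum_mul, mul_comm, Finset.sum_Ico_eq_sum_range]

end ENNReal

section sums

variable {Ω : Type*} {m₀ : MeasurableSpace Ω} {μ : Measure Ω} {𝒢 : Filtration ℕ m₀} {s : ℝ}
  {y b : ℕ → Ω → ℝ≥0∞}

/-- For `s ≤ 2` the power `s - 1` of the tail is concave, and its conditional expectation is controlled
by the one of the tail. -/
lemma lintegral_sum_rpow_le_of_le_two (hs : 1 < s) (hs2 : s ≤ 2)
    (hy : ∀ k, Measurable[𝒢 k] (y k)) (hb : ∀ k, Measurable[𝒢 k] (b k))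
    (hyb : ∀ k, ∀ᵐ x ∂μ, y k x ≤ b k x)
    (htail : ∀ k n φ, Measurable[𝒢 k] φ →
      ∫⁻ x, φ x * ∑ j ∈ Finset.range n, y (k + j) x ∂μ ≤ ∫⁻ x, φ x * b k x ∂μ) (n : ℕ) :
    ∫⁻ x, (∑ k ∈ Finset.range n, y k x) ^ s ∂μ ≤
      ENNReal.ofReal (2 * s) * ∑ k ∈ Finset.range n, ∫⁻ x, y k x * b k x ^ (s - 1) ∂μ := by
  have hy0 : ∀ k, Measurable (y k) := fun k => (hy k).mono (𝒢.le k) le_rfl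
  have hb0 : ∀ k, Measurable (b k) := fun k => (hb k).mono (𝒢.le k) le_rfl
  have hT : ∀ k, Measurable fun x => ∑ j ∈ Finset.range (n - k), y (k + j) x := fun k =>
    Finset.measurable_sum _ fun j _ => hy0 _
  calc ∫⁻ x, (∑ k ∈ Finset.range n, y k x) ^ s ∂μ
      ≤ ∫⁻ x, ENNReal.ofReal s * ∑ k ∈ Finset.range n,
          y k x * (∑ j ∈ Finset.range (n - k), y (k + j) x) ^ (s - 1) ∂μ :=
        lintegral_mono fun x => ENNReal.sum_rpow_le_sum_mul_tail (fun k => y k x) hs.le n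
    _ = ENNReal.ofReal s * ∑ k ∈ Finset.range n,
          ∫⁻ x, y k x * (∑ j ∈ Finset.range (n - k), y (k + j) x) ^ (s - 1) ∂μ := by
        have hm : ∀ k, Measurable fun x =>
          y k x * (∑ j ∈ Finset.range (n - k), y (k + j) x) ^ (s - 1) := fun k =>
            (hy0 k).mul ((hT k).pow_const _)
        rw [lintegral_const_mul _ (Finset.measurable_sum _ fun k _ => hm k),
          lintegral_finsetSum _ fun k _ => hm k]
    _ ≤ ENNReal.ofReal s * ∑ k ∈ Finset.range n, 2 * ∫⁻ x, y k x * b k x ^ (s - 1) ∂μ := by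
        gcongr ENNReal.ofReal s * ?_
        refine Finset.sum_le_sum fun k _ => ?_
        calc ∫⁻ x, y k x * (∑ j ∈ Finset.range (n - k), y (k + j) x) ^ (s - 1) ∂μ
            ≤ ∫⁻ x, y k x * b k x ^ (s - 1) + y k x * b k x ^ (s - 2) *
                ∑ j ∈ Finset.range (n - k), y (k + j) x ∂μ := by
              refine lintegral_mono_ae ?_
              filter_upwards [hyb k] with x hx
              exact ENNReal.mul_rpow_sub_one_le_of_le_two hx _ hs hs2
          _ = ∫⁻ x, y k x * b k x ^ (s - 1) ∂μ + ∫⁻ x, y k x * b k x ^ (s - 2) *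
                ∑ j ∈ Finset.range (n - k), y (k + j) x ∂μ :=
              lintegral_add_left ((hy0 k).mul ((hb0 k).pow_const _)) _
          _ ≤ ∫⁻ x, y k x * b k x ^ (s - 1) ∂μ + ∫⁻ x, y k x * b k x ^ (s - 1) ∂μ := by
              refine add_le_add le_rfl ?_
              refine (htail k (n - k) (fun x => y k x * b k x ^ (s - 2))
                ((hy k).mul ((hb k).pow_const _))).trans (lintegral_mono fun x => ?_)
              dsimp only
              rw [mul_assoc]
              gcongr
              exact ENNReal.rpow_sub_two_mul_self_le _ hs
          _ = _ := (two_mul _).symm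
    _ = _ := by
        rw [← Finset.mul_sum, ← mul_assoc, mul_comm 2 s, ENNReal.ofReal_mul (by linarith)]
        simp

/-- For `s ≥ 2` the power of the sum is bounded by a sum of products of an adapted factor and a single
tail. After conditioning, half of the left side is absorbed, which needs it to be finite. -/
lemma lintegral_sum_rpow_le_of_two_le (hs2 : 2 ≤ s)
    (hy : ∀ k, Measurable[𝒢 k] (y k)) (hb : ∀ k, Measurable[𝒢 k] (b k))
    (htail : ∀ k n φ, Measurable[𝒢 k] φ →
      ∫⁻ x, φ x * ∑ j ∈ Finset.range n, y (k + j) x ∂μ ≤ ∫⁻ x, φ x * b k x ∂μ) (n : ℕ)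
    (hfin : ∫⁻ x, (∑ k ∈ Finset.range n, y k x) ^ s ∂μ ≠ ∞) :
    ∫⁻ x, (∑ k ∈ Finset.range n, y k x) ^ s ∂μ ≤ ENNReal.ofReal (2 * s * (s - 1)) ^ (s - 1) *
      ∑ k ∈ Finset.range n, ∫⁻ x, y k x * b k x ^ (s - 1) ∂μ := by
  have hy0 : ∀ k, Measurable (y k) := fun k => (hy k).mono (𝒢.le k) le_rfl
  have hb0 : ∀ k, Measurable (b k) := fun k => (hb k).mono (𝒢.le k) le_rfl
  set I := ∫⁻ x, (∑ k ∈ Finset.range n, y k x) ^ s ∂μ with hI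
  set B := ∑ k ∈ Finset.range n, ∫⁻ x, y k x * b k x ^ (s - 1) ∂μ with hB
  -- this choice of `D` makes the coefficient of the absorbed term equal to one half
  set D := ENNReal.ofReal (2 * s * (s - 1)) with hD
  have hD0 : D ≠ 0 := by
    rw [hD, Ne, ENNReal.ofReal_eq_zero, not_le]; nlinarith
  have hDt : D ≠ ∞ := ENNReal.ofReal_ne_top
  have hD2 : ENNReal.ofReal (s * (s - 1)) = D / 2 := by
    rw [hD, mul_assoc, ENNReal.ofReal_mul two_pos.le, ENNReal.ofReal_ofNat,
      mul_comm (2 : ℝ≥0∞),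
      ENNReal.mul_div_cancel_right two_ne_zero (by simp)]
  have hSm : ∀ k, Measurable[𝒢 k] fun x => ∑ j ∈ Finset.range (k + 1), y j x := fun k =>
    Finset.measurable_sum _ fun j hj =>
      (hy j).mono (𝒢.mono (by simp only [Finset.mem_range] at hj; omega)) le_rfl
  have hS0 : ∀ k, Measurable fun x => ∑ j ∈ Finset.range (k + 1), y j x := fun k =>
    (hSm k).mono (𝒢.le k) le_rfl
  have hpt : ∀ k, ∫⁻ x, y k x * (∑ j ∈ Finset.range (k + 1), y j x) ^ (s - 2) *
      ∑ j ∈ Finset.range (n - k), y (k + j) x ∂μ ≤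
      D ^ (s - 2) * ∫⁻ x, y k x * b k x ^ (s - 1) ∂μ +
        D⁻¹ * ∫⁻ x, y k x * (∑ j ∈ Finset.range (k + 1), y j x) ^ (s - 1) ∂μ := fun k => by
    have m1 : Measurable fun x => y k x * b k x ^ (s - 1) := (hy0 k).mul ((hb0 k).pow_const _)
    have m2 : Measurable fun x => y k x * (∑ j ∈ Finset.range (k + 1), y j x) ^ (s - 1) :=
      (hy0 k).mul ((hS0 k).pow_const _)
    rw [← lintegral_const_mul _ m1, ← lintegral_const_mul _ m2,
      ← lintegral_add_left (m1.const_mul _)]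
    refine (htail k (n - k) _ ((hy k).mul ((hSm k).pow_const _))).trans
      (lintegral_mono fun x => ?_)
    calc y k x * (∑ j ∈ Finset.range (k + 1), y j x) ^ (s - 2) * b k x
        = y k x * (b k x * (∑ j ∈ Finset.range (k + 1), y j x) ^ (s - 2)) := by ring
      _ ≤ y k x * (D ^ (s - 2) * b k x ^ (s - 1) +
            D⁻¹ * (∑ j ∈ Finset.range (k + 1), y j x) ^ (s - 1)) := by
          gcongr; exact ENNReal.mul_rpow_sub_two_le _ _ hD0 hDt hs2
      _ = _ := by ring
  have hself : ∑ k ∈ Finset.range n,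
      ∫⁻ x, y k x * (∑ j ∈ Finset.range (k + 1), y j x) ^ (s - 1) ∂μ ≤ I := by
    rw [← lintegral_finsetSum (f := fun k x =>
      y k x * (∑ j ∈ Finset.range (k + 1), y j x) ^ (s - 1)) _
      fun k _ => (hy0 k).mul ((hS0 k).pow_const _)]
    refine lintegral_mono fun x => ?_
    calc ∑ k ∈ Finset.range n, y k x * (∑ j ∈ Finset.range (k + 1), y j x) ^ (s - 1)
        ≤ ∑ k ∈ Finset.range n, y k x * (∑ j ∈ Finset.range n, y j x) ^ (s - 1) := by
          refine Finset.sum_le_sum fun k hk => ?_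
          gcongr
          · linarith
          · simp only [Finset.mem_range] at hk; omega
      _ = (∑ k ∈ Finset.range n, y k x) ^ s := by
          rw [← Finset.sum_mul]
          nth_rw 1 [← ENNReal.rpow_one (∑ k ∈ Finset.range n, y k x)]
          rw [← ENNReal.rpow_add_of_nonneg _ _ zero_le_one (by linarith)]
          ring_nf
  have main : I ≤ D ^ (s - 1) * B / 2 + I / 2 :=
    calc I ≤ ∫⁻ x, D / 2 * ∑ k ∈ Finset.range n,
            y k x * (∑ j ∈ Finset.range (k + 1), y j x) ^ (s - 2) *
            ∑ j ∈ Finset.range (n - k), y (k + j) x ∂μ := lintegral_mono fun x => by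
          rw [← hD2]
          exact ENNReal.sum_rpow_le_sum_mul_partial_mul_tail (fun k => y k x) hs2 n
      _ = D / 2 * ∑ k ∈ Finset.range n, ∫⁻ x,
            y k x * (∑ j ∈ Finset.range (k + 1), y j x) ^ (s - 2) *
            ∑ j ∈ Finset.range (n - k), y (k + j) x ∂μ := by
          have hm : ∀ k, Measurable fun x =>
              y k x * (∑ j ∈ Finset.range (k + 1), y j x) ^ (s - 2) *
              ∑ j ∈ Finset.range (n - k), y (k + j) x := fun k =>
            ((hy0 k).mul ((hS0 k).pow_const _)).mul (Finset.measurable_sum _ fun j _ => hy0 _)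
          rw [lintegral_const_mul _ (Finset.measurable_sum _ fun k _ => hm k),
            lintegral_finsetSum _ fun k _ => hm k]
      _ ≤ D / 2 * ∑ k ∈ Finset.range n, (D ^ (s - 2) * ∫⁻ x, y k x * b k x ^ (s - 1) ∂μ +
            D⁻¹ * ∫⁻ x, y k x * (∑ j ∈ Finset.range (k + 1), y j x) ^ (s - 1) ∂μ) := by
          gcongr D / 2 * ?_
          exact Finset.sum_le_sum fun k _ => hpt k
      _ ≤ D / 2 * (D ^ (s - 2) * B + D⁻¹ * I) := by
          rw [Finset.sum_add_distrib, ← Finset.mul_sum, ← Finset.mul_sum]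
          gcongr
      _ = D ^ (s - 1) * B / 2 + I / 2 := by
          have e1 : D * D ^ (s - 2) = D ^ (s - 1) := by
            rw [show s - 1 = 1 + (s - 2) by ring, ENNReal.rpow_add _ _ hD0 hDt, ENNReal.rpow_one]
          have e2 : D * D⁻¹ = 1 := ENNReal.mul_inv_cancel hD0 hDt
          simp only [div_eq_mul_inv]
          calc D * 2⁻¹ * (D ^ (s - 2) * B + D⁻¹ * I)
              = (D * D ^ (s - 2)) * B * 2⁻¹ + (D * D⁻¹) * I * 2⁻¹ := by ring
            _ = _ := by rw [e1, e2, one_mul]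
  have hI2 : I / 2 ≠ ∞ := (ENNReal.div_lt_top hfin two_ne_zero).ne
  have : I / 2 ≤ D ^ (s - 1) * B / 2 := by
    refine ENNReal.le_of_add_le_add_right hI2 ?_
    rwa [ENNReal.add_halves]
  calc I = I / 2 * 2 := (ENNReal.div_mul_cancel two_ne_zero (by simp)).symm
    _ ≤ D ^ (s - 1) * B / 2 * 2 := by gcongr
    _ = _ := ENNReal.div_mul_cancel two_ne_zero (by simp)

/-- The constant in `lintegral_tsum_rpow_le`. The first summand serves exponents at most two, the second
one exponents at least two. -/
noncomputable def sumConst (s : ℝ) : ℝ≥0∞ :=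
  ENNReal.ofReal (2 * s) + ENNReal.ofReal (2 * s * (s - 1)) ^ (s - 1)

lemma sumConst_ne_top (hs : 1 < s) : sumConst s ≠ ∞ :=
  ENNReal.add_ne_top.2 ⟨ENNReal.ofReal_ne_top,
    ENNReal.rpow_ne_top_of_nonneg (by linarith) ENNReal.ofReal_ne_top⟩

/-- If the tails `∑_{j ≥ k} y_j` of a series of adapted functions have conditional expectation at most
`b_k` given `𝒢 k`, then the `s`-th moment of the sum is controlled by `∑ ∫ y_k b_k ^ (s - 1)`. -/
theorem lintegral_tsum_rpow_le [SigmaFinite (μ.trim (𝒢.le 0))] (hs : 1 < s)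
    (hy : ∀ k, Measurable[𝒢 k] (y k)) (hb : ∀ k, Measurable[𝒢 k] (b k))
    (hyb : ∀ k, ∀ᵐ x ∂μ, y k x ≤ b k x)
    (htail : ∀ k n φ, Measurable[𝒢 k] φ →
      ∫⁻ x, φ x * ∑ j ∈ Finset.range n, y (k + j) x ∂μ ≤ ∫⁻ x, φ x * b k x ∂μ) :
    ∫⁻ x, (∑' k, y k x) ^ s ∂μ ≤ sumConst s * ∑' k, ∫⁻ x, y k x * b k x ^ (s - 1) ∂μ := by
  have hy0 : ∀ k, Measurable (y k) := fun k => (hy k).mono (𝒢.le k) le_rfl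
  have hcont := fun y => (ENNReal.continuous_rpow_const (y := s)).tendsto y
  have finite : ∀ n, ∫⁻ x, (∑ k ∈ Finset.range n, y k x) ^ s ∂μ ≤
      sumConst s * ∑' k, ∫⁻ x, y k x * b k x ^ (s - 1) ∂μ := by
    intro n
    rcases le_total s 2 with hs2 | hs2
    · exact (lintegral_sum_rpow_le_of_le_two hs hs2 hy hb hyb htail n).trans
        (mul_le_mul' le_self_add (ENNReal.sum_le_tsum _))
    set A := spanningSets (μ.trim (𝒢.le 0)) with hAdef
    have hA0 : ∀ l, MeasurableSet[𝒢 0] (A l) := fun l =>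
      @measurableSet_spanningSets _ (𝒢 0) (μ.trim (𝒢.le 0)) _ l
    have hA : ∀ l k, MeasurableSet[𝒢 k] (A l) := fun l k => 𝒢.mono (Nat.zero_le k) _ (hA0 l)
    have hAfin : ∀ l, μ (A l) < ∞ := fun l => by
      rw [← trim_measurableSet_eq (𝒢.le 0) (hA0 l)]; exact measure_spanningSets_lt_top _ l
    have htr : ∀ l k, Measurable[𝒢 k] (truncate (A l) l (y k)) := fun l k =>
      measurable_truncate (hA l k) (hy k)
    refine lintegral_le_of_tendsto_of_le
      (F := fun l x => (∑ k ∈ Finset.range n, truncate (A l) l (y k) x) ^ s)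
      (fun l => (Finset.measurable_sum _ fun k _ => (htr l k).mono (𝒢.le k) le_rfl).pow_const _)
      (fun x => (hcont _).comp (tendsto_finsetSum _ fun k _ =>
        tendsto_truncate (monotone_spanningSets _) (iUnion_spanningSets _) (y k) x)) fun l => ?_
    have hfin : ∫⁻ x, (∑ k ∈ Finset.range n, truncate (A l) l (y k) x) ^ s ∂μ ≠ ∞ := by
      refine ne_of_lt (lt_of_le_of_lt (lintegral_mono (g := (A l).indicator
        fun _ => (n * l : ℝ≥0∞) ^ s) fun x => ?_) ?_)
      · refine (ENNReal.rpow_le_rpow (Finset.sum_le_sum fun k _ =>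
          truncate_le_indicator (A l) l (y k) x) (by linarith)).trans ?_
        by_cases hx : x ∈ A l <;> simp [hx, (by linarith : 0 < s)]
      · rw [lintegral_indicator (𝒢.le 0 _ (hA0 l)), setLIntegral_const]
        refine ENNReal.mul_lt_top (ENNReal.rpow_lt_top_of_nonneg (by linarith) ?_) (hAfin l)
        exact ENNReal.mul_ne_top (by simp) (by simp)
    refine (lintegral_sum_rpow_le_of_two_le hs2 (htr l) hb (fun k n φ hφ => ?_) n hfin).trans
      (mul_le_mul' le_add_self ?_)
    · refine le_trans (lintegral_mono fun x => ?_) (htail k n φ hφ)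
      gcongr
      exact truncate_le _ _ _ x
    · refine le_trans (Finset.sum_le_sum fun k _ => lintegral_mono fun x => ?_)
        (ENNReal.sum_le_tsum _)
      gcongr
      exact truncate_le _ _ _ x
  refine lintegral_le_of_tendsto_of_le (F := fun n x => (∑ k ∈ Finset.range n, y k x) ^ s)
    (fun n => (Finset.measurable_sum _ fun k _ => hy0 k).pow_const _)
    (fun x => (hcont _).comp (ENNReal.tendsto_nat_tsum _)) finite

end sums

/-! ### Conditional expectations, weights, and Wolff's inequality -/

section condLExp

variable {Ω : Type*} {m m₀ : MeasurableSpace Ω} {μ : Measure Ω}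

lemma lintegral_mul_condLExp (hm : m ≤ m₀) [SigmaFinite (μ.trim hm)] {φ X : Ω → ℝ≥0∞}
    (hφ : Measurable[m] φ) (hX : Measurable X) :
    ∫⁻ x, φ x * condLExp m μ X x ∂μ = ∫⁻ x, φ x * X x ∂μ := by
  have htrim : (μ.withDensity X).trim hm = (μ.withDensity (condLExp m μ X)).trim hm := by
    refine @Measure.ext _ m _ _ fun E hE => ?_
    rw [trim_measurableSet_eq hm hE, trim_measurableSet_eq hm hE, withDensity_apply _ (hm _ hE),
      withDensity_apply _ (hm _ hE), setLIntegral_condLExp hm μ X hE]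
  have h : ∫⁻ x, φ x ∂(μ.withDensity X) = ∫⁻ x, φ x ∂(μ.withDensity (condLExp m μ X)) := by
    rw [← lintegral_trim hm hφ, ← lintegral_trim hm hφ, htrim]
  rw [lintegral_withDensity_eq_lintegral_mul _ hX (hφ.mono hm le_rfl),
    lintegral_withDensity_eq_lintegral_mul _ (measurable_condLExp' m μ X)
    (hφ.mono hm le_rfl)] at h
  simpa [mul_comm] using h.symm

lemma condLExp_mul_left (hm : m ≤ m₀) [SigmaFinite (μ.trim hm)] {φ X : Ω → ℝ≥0∞}
    (hφ : Measurable[m] φ) (hX : Measurable X) :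
    condLExp m μ (fun x => φ x * X x) =ᵐ[μ] fun x => φ x * condLExp m μ X x := by
  refine (ae_eq_condLExp hm μ _ (hφ.fun_mul (measurable_condLExp m μ X)) fun E hE => ?_).symm
  have := lintegral_mul_condLExp (μ := μ) hm (hφ.indicator hE) hX
  rw [← lintegral_indicator (hm _ hE), ← lintegral_indicator (hm _ hE)]
  simp only [← Set.indicator_mul_left] at this
  exact this

lemma condLExp_lt_top_of_forall_setLIntegral (hm : m ≤ m₀) [SigmaFinite (μ.trim hm)]
    {X : Ω → ℝ≥0∞} (hX : ∀ E, MeasurableSet[m] E → μ E < ∞ → ∫⁻ x in E, X x ∂μ < ∞) :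
    ∀ᵐ x ∂μ, condLExp m μ X x < ∞ := by
  set A := spanningSets (μ.trim hm)
  have hA : ∀ l, MeasurableSet[m] (A l) := fun l =>
    @measurableSet_spanningSets _ m (μ.trim hm) _ l
  have key : ∀ᵐ x ∂(μ.restrict (⋃ l, A l)), condLExp m μ X x < ∞ := by
    rw [ae_restrict_iUnion_iff]
    intro l
    refine ae_lt_top (measurable_condLExp' m μ X) ?_
    rw [setLIntegral_condLExp hm μ X (hA l)]
    refine (hX _ (hA l) ?_).ne
    rw [← trim_measurableSet_eq hm (hA l)]
    exact measure_spanningSets_lt_top _ l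
  rwa [iUnion_spanningSets, Measure.restrict_univ] at key

end condLExp

section filtration

variable {Ω : Type*} {m₀ : MeasurableSpace Ω} {μ : Measure Ω} {ℱ : Filtration ℤ m₀}

/-- The part of a filtration over `ℤ` from the index `a` on, as a filtration over `ℕ`. -/
def shiftNat (ℱ : Filtration ℤ m₀) (a : ℤ) : Filtration ℕ m₀ where
  seq n := ℱ (a + n)
  mono' _ _ h := ℱ.mono (by gcongr)
  le' n := ℱ.le (a + n)

instance [SigmaFiniteFiltration μ ℱ] (a : ℤ) : SigmaFinite (μ.trim ((shiftNat ℱ a).le 0)) :=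
  inferInstanceAs (SigmaFinite (μ.trim (ℱ.le (a + (0 : ℕ)))))

theorem lintegral_iSup_int_rpow_le [SigmaFiniteFiltration μ ℱ] {t t' : ℝ}
    (h : t.HolderConjugate t') {N : ℤ → Ω → ℝ≥0∞} {g : Ω → ℝ≥0∞}
    (hN : ∀ i, Measurable[ℱ i] (N i)) (hg : Measurable g)
    (hNg : ∀ i φ, Measurable[ℱ i] φ → ∫⁻ x, φ x * N i x ∂μ ≤ ∫⁻ x, φ x * g x ∂μ) :
    ∫⁻ x, (⨆ i, N i x) ^ t ∂μ ≤ ENNReal.ofReal t' ^ t * ∫⁻ x, g x ^ t ∂μ := by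
  refine lintegral_le_of_tendsto_of_le (F := fun m x => (⨆ n : ℕ, N (-m + n) x) ^ t)
    (fun m => (Measurable.iSup fun n => (hN _).mono (ℱ.le _) le_rfl).pow_const _)
    (fun x => ((ENNReal.continuous_rpow_const (y := t)).tendsto _).comp ?_) fun m =>
      lintegral_iSup_rpow_le (𝒢 := shiftNat ℱ (-m)) h (fun k => hN (-m + k)) hg
        fun k φ hφ => hNg (-m + k) φ hφ
  have hmono : Monotone fun m : ℕ => ⨆ n : ℕ, N (-m + n) x := fun m m' hm =>
    iSup_le fun n => le_iSup_of_le (n + (m' - m)) (le_of_eq (by congr 1; push_cast [hm]; ring))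
  convert tendsto_atTop_iSup hmono using 2
  refine le_antisymm (iSup_le fun i => ?_) (iSup_le fun m => iSup_le fun n =>
    le_iSup (fun i => N i x) _)
  exact le_iSup_of_le i.natAbs (le_iSup_of_le (i + i.natAbs).toNat
    (le_of_eq (by congr 1; omega)))

theorem lintegral_tsum_int_rpow_le [SigmaFiniteFiltration μ ℱ] {s : ℝ} (hs : 1 < s)
    {y b : ℤ → Ω → ℝ≥0∞} (hy : ∀ i, Measurable[ℱ i] (y i)) (hb : ∀ i, Measurable[ℱ i] (b i))
    (hyb : ∀ i, ∀ᵐ x ∂μ, y i x ≤ b i x)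
    (htail : ∀ i φ, Measurable[ℱ i] φ →
      ∫⁻ x, φ x * ∑' n : ℕ, y (i + n) x ∂μ ≤ ∫⁻ x, φ x * b i x ∂μ) :
    ∫⁻ x, (∑' i, y i x) ^ s ∂μ ≤ sumConst s * ∑' i, ∫⁻ x, y i x * b i x ^ (s - 1) ∂μ := by
  refine lintegral_le_of_tendsto_of_le (F := fun m x => (∑' n : ℕ, y (-m + n) x) ^ s)
    (fun m => (Measurable.tsum fun n => (hy _).mono (ℱ.le _) le_rfl).pow_const _)
    (fun x => ((ENNReal.continuous_rpow_const (y := s)).tendsto _).comp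
      (ENNReal.tendsto_tsum_int_shift fun i => y i x)) fun m => ?_
  refine (lintegral_tsum_rpow_le (𝒢 := shiftNat ℱ (-m)) hs (fun k => hy (-m + k))
    (fun k => hb (-m + k)) (fun k => hyb (-m + k)) fun k n φ hφ => ?_).trans
      (mul_le_mul' le_rfl (ENNReal.tsum_comp_le_tsum_of_injective (fun a b h => by simpa using h)
        fun i => ∫⁻ x, y i x * b i x ^ (s - 1) ∂μ))
  refine le_trans (lintegral_mono fun x => ?_) (htail (-m + k) φ hφ)
  gcongr
  refine (ENNReal.sum_le_tsum _).trans (le_of_eq (tsum_congr fun j => ?_))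
  push_cast
  rw [add_assoc]

end filtration

section weight

variable {Ω : Type*} {m₀ : MeasurableSpace Ω} {μ : Measure Ω} {ℱ : Filtration ℤ m₀}
  {v g : Ω → ℝ≥0∞}

/-- The conditional expectation `E_i(g v) / E_i(v)` of `g` with respect to the measure `v dμ`, written in
terms of conditional expectations for `μ`. -/
noncomputable def weightedCondExp (ℱ : Filtration ℤ m₀) (μ : Measure Ω) (v g : Ω → ℝ≥0∞) (i : ℤ) (x : Ω) :
    ℝ≥0∞ :=
  condLExp (ℱ i) μ (fun y => g y * v y) x / condLExp (ℱ i) μ v x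

lemma measurable_weightedCondExp (i : ℤ) : Measurable[ℱ i] (weightedCondExp ℱ μ v g i) :=
  (measurable_condLExp _ _ _).fun_div (measurable_condLExp _ _ _)

variable [SigmaFiniteFiltration μ ℱ]

lemma IsWeight.condLExp_lt_top (hv : IsWeight ℱ μ v) (i : ℤ) :
    ∀ᵐ x ∂μ, condLExp (ℱ i) μ v x < ∞ :=
  condLExp_lt_top_of_forall_setLIntegral (ℱ.le i) (hv.2 i)

lemma IsWeight.sigmaFiniteFiltration (hv : IsWeight ℱ μ v) :
    SigmaFiniteFiltration (μ.withDensity v) ℱ := by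
  refine ⟨fun i => ⟨⟨⟨spanningSets (μ.trim (ℱ.le i)), fun _ => trivial, fun l => ?_,
    iUnion_spanningSets _⟩⟩⟩⟩
  have hA : MeasurableSet[ℱ i] (spanningSets (μ.trim (ℱ.le i)) l) :=
    @measurableSet_spanningSets _ (ℱ i) (μ.trim (ℱ.le i)) _ l
  rw [trim_measurableSet_eq (ℱ.le i) hA, withDensity_apply _ (ℱ.le i _ hA)]
  refine hv.2 i _ hA ?_
  rw [← trim_measurableSet_eq (ℱ.le i) hA]
  exact measure_spanningSets_lt_top _ l

lemma IsWeight.sigmaFinite_withDensity (hv : IsWeight ℱ μ v) :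
    SigmaFinite (μ.withDensity v) :=
  have := hv.sigmaFiniteFiltration
  SigmaFinite.of_trim (ℱ.le 0)

/-- Where `E_i(v) = 0` the quotient does no harm: `g v ≤ ∞ · v` gives `E_i(g v) = 0` there. -/
lemma IsWeight.weightedCondExp_mul (hv : IsWeight ℱ μ v) (i : ℤ) :
    ∀ᵐ x ∂μ, weightedCondExp ℱ μ v g i x * condLExp (ℱ i) μ v x =
      condLExp (ℱ i) μ (fun y => g y * v y) x := by
  have h1 : condLExp (ℱ i) μ (fun y => g y * v y) ≤ᵐ[μ] fun x => ∞ * condLExp (ℱ i) μ v x :=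
    (condLExp_mono (ae_of_all _ fun x => by gcongr; exact le_top)).trans
      (condLExp_mul_left (ℱ.le i) measurable_const hv.1).le
  filter_upwards [h1, hv.condLExp_lt_top i] with x hx hfin
  refine ENNReal.div_mul_cancel' (fun h0 => ?_) fun h => absurd h hfin.ne
  rwa [h0, mul_zero, nonpos_iff_eq_zero] at hx

/-- Doob's maximal inequality for the measure `v dμ`. -/
theorem IsWeight.lintegral_iSup_weightedCondExp_rpow_le (hv : IsWeight ℱ μ v) (hg : Measurable g)
    {t t' : ℝ} (h : t.HolderConjugate t') :
    ∫⁻ x, (⨆ i, weightedCondExp ℱ μ v g i x) ^ t ∂(μ.withDensity v) ≤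
      ENNReal.ofReal t' ^ t * ∫⁻ x, g x ^ t ∂(μ.withDensity v) := by
  have := hv.sigmaFiniteFiltration
  have hN : ∀ i, Measurable (weightedCondExp ℱ μ v g i) := fun i =>
    (measurable_weightedCondExp i).mono (ℱ.le i) le_rfl
  exact lintegral_iSup_int_rpow_le (μ := μ.withDensity v) (ℱ := ℱ) h
    (fun i => measurable_weightedCondExp (μ := μ) (v := v) (g := g) i) hg fun i φ hφ => by
      have hφ0 : Measurable φ := hφ.mono (ℱ.le i) le_rfl
      rw [lintegral_withDensity_eq_lintegral_mul _ hv.1 (hφ0.fun_mul (hN i)),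
        lintegral_withDensity_eq_lintegral_mul _ hv.1 (hφ0.fun_mul hg)]
      calc ∫⁻ x, v x * (φ x * weightedCondExp ℱ μ v g i x) ∂μ
          = ∫⁻ x, (φ x * weightedCondExp ℱ μ v g i x) * v x ∂μ := by simp_rw [mul_comm]
        _ = ∫⁻ x, φ x * weightedCondExp ℱ μ v g i x * condLExp (ℱ i) μ v x ∂μ :=
            (lintegral_mul_condLExp (ℱ.le i) (hφ.fun_mul (measurable_weightedCondExp i)) hv.1).symm
        _ ≤ ∫⁻ x, φ x * condLExp (ℱ i) μ (fun y => g y * v y) x ∂μ := by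
            refine lintegral_mono fun x => ?_
            dsimp only
            rw [mul_assoc]
            gcongr
            rw [mul_comm]
            exact ENNReal.mul_div_le
        _ = ∫⁻ x, v x * (φ x * g x) ∂μ := by
            rw [lintegral_mul_condLExp (ℱ.le i) hφ (hg.fun_mul hv.1)]
            refine lintegral_congr fun x => ?_
            ring

end weight

section wolff

variable {Ω : Type*} {m₀ : MeasurableSpace Ω} {μ : Measure Ω} {ℱ : Filtration ℤ m₀}
  {α : ℤ → Ω → ℝ≥0} {c : ℝ≥0}

/-- The operator `T_α f = ∑_i α_i E[f | ℱ_i]` on functions with values in `ℝ≥0∞`. -/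
noncomputable def posOpENN (ℱ : Filtration ℤ m₀) (μ : Measure Ω) (α : ℤ → Ω → ℝ≥0) (f : Ω → ℝ≥0∞) (x : Ω) :
    ℝ≥0∞ :=
  ∑' i : ℤ, (α i x : ℝ≥0∞) * condLExp (ℱ i) μ f x

/-- The `ℱ_i`-measurable version `E[ᾱ_i | ℱ_i]` of the tail sum `ᾱ_i`, to which it is comparable under
`TailCondition`. -/
noncomputable def adaptedTail (ℱ : Filtration ℤ m₀) (μ : Measure Ω) (α : ℤ → Ω → ℝ≥0) (i : ℤ) : Ω → ℝ≥0∞ :=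
  condLExp (ℱ i) μ (tailSum α i)

lemma measurable_adaptedTail (i : ℤ) : Measurable[ℱ i] (adaptedTail ℱ μ α i) :=
  measurable_condLExp _ _ _

lemma tailSum_eq_tsum_nat (α : ℤ → Ω → ℝ≥0) (i : ℤ) (x : Ω) :
    tailSum α i x = ∑' n : ℕ, (α (i + n) x : ℝ≥0∞) := by
  let e : ℕ ≃ Set.Ici i :=
    { toFun := fun n => ⟨i + n, by simp⟩
      invFun := fun j => (j.1 - i).toNat
      left_inv := fun n => by simp
      right_inv := fun ⟨j, hj⟩ => by
        have := Set.mem_Ici.1 hj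
        ext
        simp only
        omega }
  exact (e.tsum_eq fun j : Set.Ici i => (α j x : ℝ≥0∞)).symm

lemma coeff_le_tailSum (α : ℤ → Ω → ℝ≥0) (i : ℤ) (x : Ω) : (α i x : ℝ≥0∞) ≤ tailSum α i x :=
  ENNReal.le_tsum (f := fun j : Set.Ici i => (α j x : ℝ≥0∞)) ⟨i, Set.self_mem_Ici⟩

namespace TailCondition

lemma measurable_coe (hα : TailCondition ℱ μ α c) (i : ℤ) :
    Measurable[ℱ i] fun x => (α i x : ℝ≥0∞) := (hα.measurable i).coe_nnreal_ennreal

lemma measurable_coe' (hα : TailCondition ℱ μ α c) (i : ℤ) :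
    Measurable fun x => (α i x : ℝ≥0∞) := (hα.measurable_coe i).mono (ℱ.le i) le_rfl

lemma measurable_posOpENN (hα : TailCondition ℱ μ α c) (f : Ω → ℝ≥0∞) :
    Measurable (posOpENN ℱ μ α f) :=
  Measurable.tsum fun i => (hα.measurable_coe' i).fun_mul (measurable_condLExp' _ _ _)

lemma coeff_le_adaptedTail (hα : TailCondition ℱ μ α c) (i : ℤ) :
    ∀ᵐ x ∂μ, (α i x : ℝ≥0∞) ≤ c * adaptedTail ℱ μ α i x := by
  filter_upwards [hα.le_condExp i] with x hx using (coeff_le_tailSum α i x).trans hx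

variable [SigmaFiniteFiltration μ ℱ]

/-- The bilinear form of `T_α`, which is symmetric because conditional expectations are. -/
lemma lintegral_posOpENN_mul (hα : TailCondition ℱ μ α c) {f h : Ω → ℝ≥0∞} (hh : Measurable h) :
    ∫⁻ x, posOpENN ℱ μ α f x * h x ∂μ =
      ∑' i, ∫⁻ x, α i x * condLExp (ℱ i) μ f x * condLExp (ℱ i) μ h x ∂μ := by
  simp_rw [posOpENN, ← ENNReal.tsum_mul_right]
  rw [lintegral_tsum fun i => (((hα.measurable_coe' i).fun_mul
    (measurable_condLExp' _ _ _)).fun_mul hh).aemeasurable]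
  refine tsum_congr fun i => ?_
  exact (lintegral_mul_condLExp (ℱ.le i) ((hα.measurable_coe i).fun_mul (measurable_condLExp _ _ _))
    hh).symm

lemma lintegral_posOpENN_mul_comm (hα : TailCondition ℱ μ α c) {f h : Ω → ℝ≥0∞}
    (hf : Measurable f) (hh : Measurable h) :
    ∫⁻ x, posOpENN ℱ μ α f x * h x ∂μ = ∫⁻ x, f x * posOpENN ℱ μ α h x ∂μ := by
  simp_rw [mul_comm (f _)]
  rw [hα.lintegral_posOpENN_mul hh, hα.lintegral_posOpENN_mul hf]
  refine tsum_congr fun i => lintegral_congr fun x => ?_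
  ring

/-- The tail of `T_α f` from `i` on has the same conditional expectation given `ℱ_i` as `ᾱ_i f`. By
`TailCondition`, this is comparable to `E[ᾱ_i | ℱ_i] E[f | ℱ_i]`. -/
lemma lintegral_mul_tsum_tail (hα : TailCondition ℱ μ α c) (i : ℤ) {φ f : Ω → ℝ≥0∞}
    (hφ : Measurable[ℱ i] φ) (hf : Measurable f) :
    ∫⁻ x, φ x * ∑' n : ℕ, (α (i + n) x : ℝ≥0∞) * condLExp (ℱ (i + n)) μ f x ∂μ =
      ∫⁻ x, φ x * (tailSum α i x * f x) ∂μ := by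
  have hφ0 : Measurable φ := hφ.mono (ℱ.le i) le_rfl
  simp_rw [tailSum_eq_tsum_nat, ← ENNReal.tsum_mul_right, ← ENNReal.tsum_mul_left]
  rw [lintegral_tsum fun n => (hφ0.fun_mul ((hα.measurable_coe' _).fun_mul
    (measurable_condLExp' _ _ _))).aemeasurable, lintegral_tsum fun n =>
      (hφ0.fun_mul ((hα.measurable_coe' _).fun_mul hf)).aemeasurable]
  refine tsum_congr fun n => ?_
  simp_rw [← mul_assoc]
  exact lintegral_mul_condLExp (ℱ.le _)
    ((hφ.mono (ℱ.mono (by simp)) le_rfl).fun_mul (hα.measurable_coe _)) hf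

/-- **Wolff's inequality**, upper bound. -/
theorem lintegral_posOpENN_rpow_le (hα : TailCondition ℱ μ α c) {s : ℝ} (hs : 1 < s)
    {f : Ω → ℝ≥0∞} (hf : Measurable f) :
    ∫⁻ x, posOpENN ℱ μ α f x ^ s ∂μ ≤ sumConst s * c ^ (s - 1) *
      ∑' i, ∫⁻ x, α i x * adaptedTail ℱ μ α i x ^ (s - 1) * condLExp (ℱ i) μ f x ^ s ∂μ := by
  have hs0 : 0 ≤ s - 1 := by linarith
  have hf' := fun i => measurable_condLExp (ℱ i) μ f
  have ha := fun i => measurable_adaptedTail (ℱ := ℱ) (μ := μ) (α := α) i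
  have key := lintegral_tsum_int_rpow_le (μ := μ) (ℱ := ℱ) hs
    (y := fun i x => (α i x : ℝ≥0∞) * condLExp (ℱ i) μ f x)
    (b := fun i x => c * adaptedTail ℱ μ α i x * condLExp (ℱ i) μ f x)
    (fun i => (hα.measurable_coe i).fun_mul (hf' i)) (fun i => ((ha i).const_mul _).fun_mul (hf' i))
    (fun i => by
      filter_upwards [hα.coeff_le_adaptedTail i] with x hx
      gcongr)
    fun i φ hφ => by
      rw [hα.lintegral_mul_tsum_tail i hφ hf]
      calc ∫⁻ x, φ x * (tailSum α i x * f x) ∂μ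
          ≤ ∫⁻ x, φ x * (c * adaptedTail ℱ μ α i x) * f x ∂μ := by
            refine lintegral_mono_ae ?_
            filter_upwards [hα.le_condExp i] with x hx
            rw [mul_assoc]
            gcongr
            exact hx
        _ = _ := by
            rw [← lintegral_mul_condLExp (ℱ.le i) (hφ.fun_mul ((ha i).const_mul _)) hf]
            simp_rw [mul_assoc]
  refine key.trans (le_of_eq ?_)
  rw [mul_assoc, ← ENNReal.tsum_mul_left (a := (c : ℝ≥0∞) ^ (s - 1))]
  congr 1
  refine tsum_congr fun i => ?_
  rw [← lintegral_const_mul _ (((hα.measurable_coe' i).fun_mul (((ha i).mono (ℱ.le i) le_rfl).pow_const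
    _)).fun_mul ((measurable_condLExp' _ _ _).pow_const _))]
  refine lintegral_congr fun x => ?_
  rw [ENNReal.mul_rpow_of_nonneg _ _ hs0, ENNReal.mul_rpow_of_nonneg _ _ hs0,
    show s = 1 + (s - 1) by ring, ENNReal.rpow_add_of_nonneg _ _ zero_le_one hs0,
    ENNReal.rpow_one, ← show s = 1 + (s - 1) by ring]
  ring

/-- **Wolff's inequality**, lower bound: each `E[ᾱ_i | ℱ_i] E[f | ℱ_i]` is at most a constant times
`E[T_α f | ℱ_i]`, so that their supremum is controlled by Doob's inequality. -/
theorem tsum_lintegral_le_lintegral_posOpENN_rpow (hα : TailCondition ℱ μ α c) {s s' : ℝ}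
    (h : s.HolderConjugate s') {f : Ω → ℝ≥0∞} (hf : Measurable f) :
    ∑' i, ∫⁻ x, α i x * adaptedTail ℱ μ α i x ^ (s - 1) * condLExp (ℱ i) μ f x ^ s ∂μ ≤
      (ENNReal.ofReal s' ^ s * c ^ s + 1) * ∫⁻ x, posOpENN ℱ μ α f x ^ s ∂μ := by
  have hs0 : 0 ≤ s - 1 := h.sub_one_pos.le
  have hf' := fun i => measurable_condLExp (ℱ i) μ f
  have ha := fun i => measurable_adaptedTail (ℱ := ℱ) (μ := μ) (α := α) i
  have hT := hα.measurable_posOpENN f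
  set M : Ω → ℝ≥0∞ := fun x => ⨆ i, adaptedTail ℱ μ α i x * condLExp (ℱ i) μ f x with hM
  have hMm : Measurable M :=
    Measurable.iSup fun i => ((ha i).fun_mul (hf' i)).mono (ℱ.le i) le_rfl
  have hmax := lintegral_iSup_int_rpow_le (μ := μ) (ℱ := ℱ) h
    (N := fun i x => adaptedTail ℱ μ α i x * condLExp (ℱ i) μ f x)
    (fun i => (ha i).fun_mul (hf' i)) (hT.const_mul (c : ℝ≥0∞)) fun i φ hφ => by
      have hφ0 : Measurable φ := hφ.mono (ℱ.le i) le_rfl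
      calc ∫⁻ x, φ x * (adaptedTail ℱ μ α i x * condLExp (ℱ i) μ f x) ∂μ
          = ∫⁻ x, φ x * adaptedTail ℱ μ α i x * f x ∂μ := by
            rw [← lintegral_mul_condLExp (ℱ.le i) (hφ.fun_mul (ha i)) hf]
            simp_rw [mul_assoc]
        _ ≤ ∫⁻ x, c * φ x * (tailSum α i x * f x) ∂μ := by
            refine lintegral_mono_ae ?_
            filter_upwards [hα.condExp_le i] with x hx
            calc φ x * adaptedTail ℱ μ α i x * f x ≤ φ x * (c * tailSum α i x) * f x := by
                  gcongr; exact hx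
              _ = _ := by ring
        _ = ∫⁻ x, c * φ x *
              ∑' n : ℕ, (α (i + n) x : ℝ≥0∞) * condLExp (ℱ (i + n)) μ f x ∂μ :=
            (hα.lintegral_mul_tsum_tail i (hφ.const_mul _) hf).symm
        _ ≤ ∫⁻ x, φ x * (c * posOpENN ℱ μ α f x) ∂μ := by
            refine lintegral_mono fun x => ?_
            dsimp only
            rw [mul_comm (c : ℝ≥0∞), mul_assoc]
            gcongr
            exact ENNReal.tsum_comp_le_tsum_of_injective (fun a b h => by simpa using h)
              fun i => (α i x : ℝ≥0∞) * condLExp (ℱ i) μ f x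
  simp_rw [ENNReal.mul_rpow_of_nonneg _ _ h.nonneg] at hmax
  rw [lintegral_const_mul _ (hT.pow_const _), ← mul_assoc] at hmax
  rw [← lintegral_tsum fun i => (((hα.measurable_coe' i).fun_mul (((ha i).mono (ℱ.le i)
    le_rfl).pow_const _)).fun_mul ((measurable_condLExp' _ _ _).pow_const _)).aemeasurable]
  calc ∫⁻ x, ∑' i, α i x * adaptedTail ℱ μ α i x ^ (s - 1) * condLExp (ℱ i) μ f x ^ s ∂μ
      ≤ ∫⁻ x, M x ^ s + posOpENN ℱ μ α f x ^ s ∂μ := by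
        refine lintegral_mono fun x => ?_
        have e : ∀ z : ℝ≥0∞, z ^ (s - 1) * z = z ^ s := fun z => by
          nth_rw 2 [← ENNReal.rpow_one z]
          rw [← ENNReal.rpow_add_of_nonneg _ _ hs0 zero_le_one, sub_add_cancel]
        calc ∑' i, α i x * adaptedTail ℱ μ α i x ^ (s - 1) * condLExp (ℱ i) μ f x ^ s
            ≤ ∑' i, M x ^ (s - 1) * (α i x * condLExp (ℱ i) μ f x) := by
              refine ENNReal.tsum_le_tsum fun i => ?_
              calc α i x * adaptedTail ℱ μ α i x ^ (s - 1) * condLExp (ℱ i) μ f x ^ s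
                  = (adaptedTail ℱ μ α i x * condLExp (ℱ i) μ f x) ^ (s - 1) *
                      (α i x * condLExp (ℱ i) μ f x) := by
                    rw [ENNReal.mul_rpow_of_nonneg _ _ hs0, ← e (condLExp (ℱ i) μ f x)]
                    ring
                _ ≤ _ := by
                    gcongr
                    exact le_iSup (fun i => adaptedTail ℱ μ α i x * condLExp (ℱ i) μ f x) i
          _ = M x ^ (s - 1) * posOpENN ℱ μ α f x := ENNReal.tsum_mul_left
          _ ≤ M x ^ s + posOpENN ℱ μ α f x ^ s := by
              rcases le_total (M x) (posOpENN ℱ μ α f x) with hle | hle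
              · refine le_add_left ?_
                rw [← e (posOpENN ℱ μ α f x)]
                gcongr
              · refine le_add_right ?_
                rw [← e (M x)]
                gcongr
    _ = ∫⁻ x, M x ^ s ∂μ + ∫⁻ x, posOpENN ℱ μ α f x ^ s ∂μ :=
        lintegral_add_left (hMm.pow_const _) _
    _ ≤ _ := by
        rw [add_mul, one_mul]
        exact add_le_add hmax le_rfl

end TailCondition

end wolff

/-! ### The adapted potential: trace inequalities with exponent above one, and necessity -/

lemma ENNReal.rpow_sub_one_mul_self (z : ℝ≥0∞) {s : ℝ} (hs : 1 ≤ s) : z ^ (s - 1) * z = z ^ s := by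
  nth_rw 2 [← ENNReal.rpow_one z]
  rw [← ENNReal.rpow_add_of_nonneg _ _ (by linarith) zero_le_one, sub_add_cancel]

/-- A series of terms divided by a power below one of their partial sums. -/
lemma ENNReal.tsum_mul_partial_rpow_neg_le (x : ℤ → ℝ≥0∞) {γ : ℝ} (hγ0 : 0 ≤ γ) (hγ : γ < 1) :
    ∑' j, x j * (∑' n : ℕ, x (j - n)) ^ (-γ) ≤
      (ENNReal.ofReal (1 - γ))⁻¹ * (∑' j, x j) ^ (1 - γ) := by
  refine le_of_tendsto' (ENNReal.tendsto_tsum_int_shift _) fun m => ?_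
  refine ENNReal.tsum_le_of_sum_range_le fun N => ?_
  have hc0 : ENNReal.ofReal (1 - γ) ≠ 0 := by
    rw [Ne, ENNReal.ofReal_eq_zero, not_le]; linarith
  rw [mul_comm, ← div_eq_mul_inv, ENNReal.le_div_iff_mul_le (.inl hc0) (.inl ENNReal.ofReal_ne_top),
    mul_comm]
  calc ENNReal.ofReal (1 - γ) *
        ∑ k ∈ Finset.range N, x (-m + k) * (∑' n : ℕ, x (-m + k - n)) ^ (-γ)
      ≤ ENNReal.ofReal (1 - γ) * ∑ k ∈ Finset.range N,
          x (-m + k) * (∑ j ∈ Finset.range (k + 1), x (-m + j)) ^ (1 - γ - 1) := by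
        gcongr with k _
        rw [show 1 - γ - 1 = -γ by ring, ENNReal.rpow_neg, ENNReal.rpow_neg]
        refine ENNReal.inv_le_inv.2 (ENNReal.rpow_le_rpow ?_ hγ0)
        rw [← Finset.sum_range_reflect]
        refine le_trans (le_of_eq (Finset.sum_congr rfl fun j hj => ?_))
          (ENNReal.sum_le_tsum (Finset.range (k + 1)))
        simp only [Finset.mem_range] at hj
        congr 1
        omega
    _ ≤ (∑ k ∈ Finset.range N, x (-m + k)) ^ (1 - γ) :=
        ENNReal.sum_mul_partial_le_sum_rpow (fun k : ℕ => x (-m + k)) (by linarith) (by linarith) N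
    _ ≤ (∑' j, x j) ^ (1 - γ) := by
        refine ENNReal.rpow_le_rpow ((ENNReal.sum_le_tsum _).trans ?_) (by linarith)
        exact ENNReal.tsum_comp_le_tsum_of_injective (fun a b h => by simpa using h) x

lemma lintegral_withDensity_eq_lintegral_mul_right {Ω : Type*} {m₀ : MeasurableSpace Ω}
    {μ : Measure Ω} {w F : Ω → ℝ≥0∞} (hw : Measurable w) (hF : Measurable F) :
    ∫⁻ x, F x ∂(μ.withDensity w) = ∫⁻ x, F x * w x ∂μ := by
  rw [lintegral_withDensity_eq_lintegral_mul _ hw hF]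
  simp only [Pi.mul_apply, mul_comm]

section wolff

variable {Ω : Type*} {m₀ : MeasurableSpace Ω} {μ : Measure Ω} {ℱ : Filtration ℤ m₀}
  {α : ℤ → Ω → ℝ≥0} {c : ℝ≥0}

/-- The `i`-th term of the potential `adaptedWolff`. -/
noncomputable def adaptedWolffTerm (ℱ : Filtration ℤ m₀) (μ : Measure Ω) (α : ℤ → Ω → ℝ≥0) (s : ℝ)
    (v : Ω → ℝ≥0∞) (i : ℤ) (x : Ω) : ℝ≥0∞ :=
  α i x * adaptedTail ℱ μ α i x ^ (s - 1) * condLExp (ℱ i) μ v x ^ (s - 1)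

/-- The Wolff potential of `v` with every tail sum `ᾱ_i` replaced by its conditional expectation given
`ℱ_i`, which makes each term `ℱ_i`-measurable. The exponent `s` plays the role of `p'`. -/
noncomputable def adaptedWolff (ℱ : Filtration ℤ m₀) (μ : Measure Ω) (α : ℤ → Ω → ℝ≥0) (s : ℝ)
    (v : Ω → ℝ≥0∞) (x : Ω) : ℝ≥0∞ :=
  ∑' i, adaptedWolffTerm ℱ μ α s v i x

namespace TailCondition

lemma measurable_adaptedWolffTerm (hα : TailCondition ℱ μ α c) (s : ℝ) (v : Ω → ℝ≥0∞) (i : ℤ) :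
    Measurable[ℱ i] (adaptedWolffTerm ℱ μ α s v i) :=
  ((hα.measurable_coe i).fun_mul ((measurable_adaptedTail i).pow_const _)).fun_mul
    ((measurable_condLExp _ _ _).pow_const _)

lemma measurable_adaptedWolff (hα : TailCondition ℱ μ α c) (s : ℝ) (v : Ω → ℝ≥0∞) :
    Measurable (adaptedWolff ℱ μ α s v) :=
  Measurable.tsum fun i => (hα.measurable_adaptedWolffTerm s v i).mono (ℱ.le i) le_rfl

variable [SigmaFiniteFiltration μ ℱ]

/-- The potential integrates against `h v dμ` term by term, and each term sees `h v` only through its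
conditional expectation. -/
lemma lintegral_adaptedWolff_mul (hα : TailCondition ℱ μ α c) (s : ℝ) {v h : Ω → ℝ≥0∞}
    (hv : Measurable v) (hh : Measurable h) :
    ∫⁻ x, adaptedWolff ℱ μ α s v x * h x ∂(μ.withDensity v) =
      ∑' i, ∫⁻ x, adaptedWolffTerm ℱ μ α s v i x * condLExp (ℱ i) μ (fun y => h y * v y) x ∂μ := by
  rw [lintegral_withDensity_eq_lintegral_mul_right hv ((hα.measurable_adaptedWolff s v).fun_mul hh)]
  simp_rw [adaptedWolff, ← ENNReal.tsum_mul_right]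
  rw [lintegral_tsum fun i => ((((hα.measurable_adaptedWolffTerm s v i).mono (ℱ.le i)
    le_rfl).fun_mul hh).fun_mul hv).aemeasurable]
  refine tsum_congr fun i => ?_
  rw [lintegral_mul_condLExp (ℱ.le i) (hα.measurable_adaptedWolffTerm s v i) (hh.fun_mul hv)]
  simp_rw [mul_assoc]

/-- The dual form of the trace inequality for exponents above one: Wolff's inequality, Doob's inequality
for `v dμ`, and Hölder's inequality. -/
theorem lintegral_posOpENN_mul_weight_rpow_le (hα : TailCondition ℱ μ α c) {v : Ω → ℝ≥0∞}
    (hv : IsWeight ℱ μ v) {s : ℝ} (hs : 1 < s) {q q' R R' : ℝ} (hq : q'.HolderConjugate q)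
    (hR : R.HolderConjugate R') (hRq : s * R' = q') {g : Ω → ℝ≥0∞} (hg : Measurable g) :
    ∫⁻ x, posOpENN ℱ μ α (fun y => g y * v y) x ^ s ∂μ ≤ sumConst s * c ^ (s - 1) *
      ((∫⁻ x, adaptedWolff ℱ μ α s v x ^ R ∂(μ.withDensity v)) ^ (1 / R) *
        (ENNReal.ofReal q ^ q' * ∫⁻ x, g x ^ q' ∂(μ.withDensity v)) ^ (1 / R')) := by
  set N := weightedCondExp ℱ μ v g with hN
  have hNm : ∀ i, Measurable[ℱ i] (N i) := measurable_weightedCondExp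
  have hMm : Measurable fun x => ⨆ i, N i x :=
    Measurable.iSup fun i => (hNm i).mono (ℱ.le i) le_rfl
  refine (hα.lintegral_posOpENN_rpow_le hs (hg.fun_mul hv.1)).trans ?_
  gcongr
  calc ∑' i, ∫⁻ x, α i x * adaptedTail ℱ μ α i x ^ (s - 1) *
          condLExp (ℱ i) μ (fun y => g y * v y) x ^ s ∂μ
      = ∑' i, ∫⁻ x, adaptedWolffTerm ℱ μ α s v i x * N i x ^ s * condLExp (ℱ i) μ v x ∂μ := by
        refine tsum_congr fun i => lintegral_congr_ae ?_
        filter_upwards [hv.weightedCondExp_mul (g := g) i] with x hx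
        rw [← hx, ENNReal.mul_rpow_of_nonneg _ _ (by linarith),
          ← ENNReal.rpow_sub_one_mul_self (condLExp (ℱ i) μ v x) hs.le, adaptedWolffTerm]
        ring
    _ = ∑' i, ∫⁻ x, adaptedWolffTerm ℱ μ α s v i x * N i x ^ s ∂(μ.withDensity v) := by
        refine tsum_congr fun i => ?_
        have hm := (hα.measurable_adaptedWolffTerm s v i).fun_mul ((hNm i).pow_const s)
        rw [lintegral_mul_condLExp (ℱ.le i) hm hv.1,
          lintegral_withDensity_eq_lintegral_mul_right hv.1 (hm.mono (ℱ.le i) le_rfl)]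
    _ ≤ ∫⁻ x, adaptedWolff ℱ μ α s v x * (⨆ i, N i x) ^ s ∂(μ.withDensity v) := by
        rw [← lintegral_tsum fun i => (((hα.measurable_adaptedWolffTerm s v i).fun_mul
          ((hNm i).pow_const s)).mono (ℱ.le i) le_rfl).aemeasurable]
        refine lintegral_mono fun x => ?_
        dsimp only
        rw [adaptedWolff, ← ENNReal.tsum_mul_right]
        gcongr with i
        exact le_iSup (fun i => N i x) i
    _ ≤ (∫⁻ x, adaptedWolff ℱ μ α s v x ^ R ∂(μ.withDensity v)) ^ (1 / R) *
          (∫⁻ x, ((⨆ i, N i x) ^ s) ^ R' ∂(μ.withDensity v)) ^ (1 / R') :=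
        ENNReal.lintegral_mul_le_Lp_mul_Lq _ hR (hα.measurable_adaptedWolff s v).aemeasurable
          (hMm.pow_const _).aemeasurable
    _ ≤ _ := by
        simp_rw [← ENNReal.rpow_mul, hRq]
        gcongr
        · exact hR.symm.one_div_nonneg
        · exact hv.lintegral_iSup_weightedCondExp_rpow_le hg hq

/-- Sufficiency of the potential bound for exponents `q > 1`, by duality. -/
theorem lintegral_posOpENN_rpow_withDensity_le_of_one_lt (hα : TailCondition ℱ μ α c)
    {v : Ω → ℝ≥0∞} (hv : IsWeight ℱ μ v) {s p : ℝ} (hs : s.HolderConjugate p) {q q' R R' : ℝ}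
    (hq : q.HolderConjugate q') (hR : R.HolderConjugate R') (hRq : s * R' = q')
    {f : Ω → ℝ≥0∞} (hf : Measurable f) :
    ∫⁻ x, posOpENN ℱ μ α f x ^ q ∂(μ.withDensity v) ≤
      ((∫⁻ x, f x ^ p ∂μ) ^ (1 / p) * (sumConst s * c ^ (s - 1) *
        ((∫⁻ x, adaptedWolff ℱ μ α s v x ^ R ∂(μ.withDensity v)) ^ (1 / R) *
          (ENNReal.ofReal q ^ q') ^ (1 / R'))) ^ (1 / s)) ^ q := by
  have := hv.sigmaFinite_withDensity
  refine lintegral_rpow_le_of_forall_dual hq (hα.measurable_posOpENN f) fun g hg _ => ?_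
  have hgv : Measurable fun y => g y * v y := hg.fun_mul hv.1
  calc ∫⁻ x, posOpENN ℱ μ α f x * g x ∂(μ.withDensity v)
      = ∫⁻ x, f x * posOpENN ℱ μ α (fun y => g y * v y) x ∂μ := by
        rw [lintegral_withDensity_eq_lintegral_mul_right hv.1 ((hα.measurable_posOpENN f).fun_mul hg),
          ← hα.lintegral_posOpENN_mul_comm hf hgv]
        simp_rw [mul_assoc]
    _ ≤ (∫⁻ x, f x ^ p ∂μ) ^ (1 / p) *
          (∫⁻ x, posOpENN ℱ μ α (fun y => g y * v y) x ^ s ∂μ) ^ (1 / s) :=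
        ENNReal.lintegral_mul_le_Lp_mul_Lq _ hs.symm hf.aemeasurable
          (hα.measurable_posOpENN _).aemeasurable
    _ ≤ (∫⁻ x, f x ^ p ∂μ) ^ (1 / p) * (sumConst s * c ^ (s - 1) *
          ((∫⁻ x, adaptedWolff ℱ μ α s v x ^ R ∂(μ.withDensity v)) ^ (1 / R) *
          (ENNReal.ofReal q ^ q' * ∫⁻ x, g x ^ q' ∂(μ.withDensity v)) ^ (1 / R'))) ^ (1 / s) := by
        gcongr
        · exact hs.one_div_nonneg
        · exact hα.lintegral_posOpENN_mul_weight_rpow_le hv hs.lt hq.symm hR hRq hg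
    _ = _ := by
        rw [ENNReal.mul_rpow_of_nonneg _ _ hR.symm.one_div_nonneg, ← mul_assoc, ← mul_assoc,
          ENNReal.mul_rpow_of_nonneg _ _ hs.one_div_nonneg, ← ENNReal.rpow_mul, ← ENNReal.rpow_mul, mul_assoc,
          show 1 / R' * (1 / s) = 1 / q' by rw [← hRq]; field_simp]
        exact (mul_assoc _ _ _).symm

/-- Necessity of the potential bound for `q > 1`. The dual trace inequality is tested on
`g = (sup_i E_i(h w) / E_i(w)) ^ (1 / s)`: then `E_i(g w) ^ s ≥ E_i(w) ^ (s - 1) E_i(h w)`, and Wolff's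
lower bound gives an estimate of `∫ W h w` that is linear in `h`. -/
theorem lintegral_adaptedWolff_rpow_le (hα : TailCondition ℱ μ α c) {w : Ω → ℝ≥0∞}
    (hw : IsWeight ℱ μ w) {s p : ℝ} (hs : s.HolderConjugate p) {q q' R R' : ℝ}
    (hq : q.HolderConjugate q') (hR : R.HolderConjugate R') (hRq : s * R' = q') {C₁ : ℝ≥0∞}
    (htrace : ∀ f : Ω → ℝ≥0∞, Measurable f → ∫⁻ x, f x ^ p ∂μ ≠ ∞ →
      (∫⁻ x, posOpENN ℱ μ α f x ^ q ∂(μ.withDensity w)) ^ (1 / q) ≤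
        C₁ * (∫⁻ x, f x ^ p ∂μ) ^ (1 / p)) :
    ∫⁻ x, adaptedWolff ℱ μ α s w x ^ R ∂(μ.withDensity w) ≤
      ((ENNReal.ofReal p ^ s * c ^ s + 1) * C₁ ^ s * ENNReal.ofReal R) ^ R := by
  have := hw.sigmaFinite_withDensity
  have : SigmaFinite μ := SigmaFinite.of_trim (ℱ.le 0)
  -- the trace inequality in its dual form
  have dual : ∀ g : Ω → ℝ≥0∞, Measurable g →
      ∫⁻ x, posOpENN ℱ μ α (fun y => g y * w y) x ^ s ∂μ ≤
        (C₁ * (∫⁻ x, g x ^ q' ∂(μ.withDensity w)) ^ (1 / q')) ^ s := by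
    intro g hg
    refine lintegral_rpow_le_of_forall_dual hs (hα.measurable_posOpENN _) fun f hf hfin => ?_
    calc ∫⁻ x, posOpENN ℱ μ α (fun y => g y * w y) x * f x ∂μ
        = ∫⁻ x, posOpENN ℱ μ α f x * g x ∂(μ.withDensity w) := by
          rw [lintegral_withDensity_eq_lintegral_mul_right hw.1
            ((hα.measurable_posOpENN f).fun_mul hg),
            hα.lintegral_posOpENN_mul_comm (hg.fun_mul hw.1) hf]
          refine lintegral_congr fun x => ?_
          ring
      _ ≤ (∫⁻ x, posOpENN ℱ μ α f x ^ q ∂(μ.withDensity w)) ^ (1 / q) *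
            (∫⁻ x, g x ^ q' ∂(μ.withDensity w)) ^ (1 / q') :=
          ENNReal.lintegral_mul_le_Lp_mul_Lq _ hq (hα.measurable_posOpENN f).aemeasurable
            hg.aemeasurable
      _ ≤ C₁ * (∫⁻ x, f x ^ p ∂μ) ^ (1 / p) *
            (∫⁻ x, g x ^ q' ∂(μ.withDensity w)) ^ (1 / q') := by
          gcongr
          exact htrace f hf hfin
      _ = _ := by ring
  refine lintegral_rpow_le_of_forall_dual hR (hα.measurable_adaptedWolff s w) fun h hh _ => ?_
  set N := weightedCondExp ℱ μ w h with hN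
  have hNm : ∀ i, Measurable[ℱ i] (N i) := measurable_weightedCondExp
  have hMm : Measurable fun x => ⨆ i, N i x :=
    Measurable.iSup fun i => (hNm i).mono (ℱ.le i) le_rfl
  set g : Ω → ℝ≥0∞ := fun x => (⨆ i, N i x) ^ (1 / s) with hg
  have hgm : Measurable g := hMm.pow_const _
  have hgw : Measurable fun y => g y * w y := hgm.fun_mul hw.1
  calc ∫⁻ x, adaptedWolff ℱ μ α s w x * h x ∂(μ.withDensity w)
      = ∑' i, ∫⁻ x, adaptedWolffTerm ℱ μ α s w i x *
          condLExp (ℱ i) μ (fun y => h y * w y) x ∂μ := hα.lintegral_adaptedWolff_mul s hw.1 hh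
    _ ≤ ∑' i, ∫⁻ x, α i x * adaptedTail ℱ μ α i x ^ (s - 1) *
          condLExp (ℱ i) μ (fun y => g y * w y) x ^ s ∂μ := by
        refine ENNReal.tsum_le_tsum fun i => lintegral_mono_ae ?_
        have h1 : (fun x => N i x ^ (1 / s) * condLExp (ℱ i) μ w x) ≤ᵐ[μ]
            condLExp (ℱ i) μ (fun y => g y * w y) :=
          (condLExp_mul_left (ℱ.le i) ((hNm i).pow_const _) hw.1).symm.le.trans
            (condLExp_mono (ae_of_all _ fun x => mul_le_mul'
              (ENNReal.rpow_le_rpow (le_iSup (fun i => N i x) i) hs.one_div_nonneg) le_rfl))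
        filter_upwards [h1, hw.weightedCondExp_mul (g := h) i] with x hx1 hx2
        rw [← hx2, adaptedWolffTerm]
        calc α i x * adaptedTail ℱ μ α i x ^ (s - 1) * condLExp (ℱ i) μ w x ^ (s - 1) *
              (N i x * condLExp (ℱ i) μ w x)
            = α i x * adaptedTail ℱ μ α i x ^ (s - 1) *
                (N i x ^ (1 / s) * condLExp (ℱ i) μ w x) ^ s := by
              rw [ENNReal.mul_rpow_of_nonneg _ _ hs.nonneg, ← ENNReal.rpow_mul,
                one_div_mul_cancel hs.ne_zero, ENNReal.rpow_one,
                ← ENNReal.rpow_sub_one_mul_self (condLExp (ℱ i) μ w x) hs.lt.le]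
              ring
          _ ≤ _ := by
              gcongr
              exact hs.nonneg
    _ ≤ (ENNReal.ofReal p ^ s * c ^ s + 1) *
          ∫⁻ x, posOpENN ℱ μ α (fun y => g y * w y) x ^ s ∂μ :=
        hα.tsum_lintegral_le_lintegral_posOpENN_rpow hs hgw
    _ ≤ (ENNReal.ofReal p ^ s * c ^ s + 1) *
          (C₁ * (∫⁻ x, g x ^ q' ∂(μ.withDensity w)) ^ (1 / q')) ^ s := by
        gcongr
        exact dual g hgm
    _ = (ENNReal.ofReal p ^ s * c ^ s + 1) * (C₁ ^ s *
          (∫⁻ x, (⨆ i, N i x) ^ R' ∂(μ.withDensity w)) ^ (1 / R')) := by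
        have e1 : 1 / s * q' = R' := by rw [← hRq]; field_simp [hs.ne_zero]
        have e2 : 1 / q' * s = 1 / R' := by rw [← hRq]; field_simp [hs.ne_zero]
        rw [ENNReal.mul_rpow_of_nonneg _ _ hs.nonneg, ← ENNReal.rpow_mul, e2]
        simp_rw [hg, ← ENNReal.rpow_mul, e1]
    _ ≤ (ENNReal.ofReal p ^ s * c ^ s + 1) * (C₁ ^ s *
          (ENNReal.ofReal R ^ R' * ∫⁻ x, h x ^ R' ∂(μ.withDensity w)) ^ (1 / R')) := by
        gcongr
        · exact hR.symm.one_div_nonneg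
        · exact hw.lintegral_iSup_weightedCondExp_rpow_le hh hR.symm
    _ = _ := by
        rw [ENNReal.mul_rpow_of_nonneg _ _ hR.symm.one_div_nonneg, ← ENNReal.rpow_mul,
          mul_one_div_cancel hR.symm.ne_zero, ENNReal.rpow_one]
        ring

end TailCondition

end wolff

/-! ### Damping the weight: sufficiency for all exponents -/

lemma ENNReal.rpow_neg_anti {a b : ℝ≥0∞} (h : a ≤ b) {β : ℝ} (hβ : 0 ≤ β) :
    b ^ (-β) ≤ a ^ (-β) := by
  rw [ENNReal.rpow_neg, ENNReal.rpow_neg]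
  exact ENNReal.inv_le_inv.2 (ENNReal.rpow_le_rpow h hβ)

lemma ENNReal.tendsto_mul_min_natCast (a b : ℝ≥0∞) :
    Tendsto (fun n : ℕ => a * min b n) atTop (𝓝 (a * b)) := by
  have hmono : Monotone fun n : ℕ => a * min b n := fun m n h => by dsimp only; gcongr
  convert tendsto_atTop_iSup hmono using 2
  rw [← ENNReal.mul_iSup, ← inf_iSup_eq, ENNReal.iSup_natCast, inf_top_eq]

lemma IsWeight.mono {Ω : Type*} {m₀ : MeasurableSpace Ω} {μ : Measure Ω} {ℱ : Filtration ℤ m₀}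
    {v w : Ω → ℝ≥0∞} (hw : IsWeight ℱ μ w) (hv : Measurable v) {a : ℝ≥0∞} (ha : a ≠ ∞)
    (hvw : ∀ x, v x ≤ a * w x) : IsWeight ℱ μ v :=
  ⟨hv, fun i E hE hμE => by
    refine lt_of_le_of_lt (lintegral_mono hvw) ?_
    rw [lintegral_const_mul _ hw.1]
    exact ENNReal.mul_lt_top ha.lt_top (hw.2 i E hE hμE)⟩

lemma condLExp_ne_zero_withDensity {Ω : Type*} {m₀ : MeasurableSpace Ω} {μ : Measure Ω}
    {ℱ : Filtration ℤ m₀} [SigmaFiniteFiltration μ ℱ] (w : Ω → ℝ≥0∞) (i : ℤ) :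
    ∀ᵐ x ∂(μ.withDensity w), condLExp (ℱ i) μ w x ≠ 0 := by
  have hB : MeasurableSet[ℱ i] {x | condLExp (ℱ i) μ w x = 0} :=
    measurable_condLExp (ℱ i) μ w (measurableSet_singleton 0)
  rw [ae_iff]
  simp only [ne_eq, not_not]
  rw [withDensity_apply _ (ℱ.le i _ hB), ← setLIntegral_condLExp (ℱ.le i) μ w hB]
  exact setLIntegral_eq_zero (ℱ.le i _ hB) fun x hx => hx

namespace TailCondition

variable {Ω : Type*} {m₀ : MeasurableSpace Ω} {μ : Measure Ω} {ℱ : Filtration ℤ m₀}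
  {α : ℤ → Ω → ℝ≥0} {c : ℝ≥0} [SigmaFiniteFiltration μ ℱ]

lemma posOpENN_eq_zero_of_adaptedWolff_eq_zero (hα : TailCondition ℱ μ α c)
    (w : Ω → ℝ≥0∞) {s : ℝ} (hs : 1 < s) (f : Ω → ℝ≥0∞) :
    ∀ᵐ x ∂(μ.withDensity w), adaptedWolff ℱ μ α s w x = 0 → posOpENN ℱ μ α f x = 0 := by
  have h1 : ∀ᵐ x ∂(μ.withDensity w), ∀ i, (α i x : ℝ≥0∞) ≤ c * adaptedTail ℱ μ α i x :=
    (withDensity_absolutelyContinuous μ w).ae_le (ae_all_iff.2 hα.coeff_le_adaptedTail)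
  filter_upwards [h1, ae_all_iff.2 (condLExp_ne_zero_withDensity (ℱ := ℱ) w)] with x hx1 hx2 h0
  simp only [adaptedWolff, adaptedWolffTerm, ENNReal.tsum_eq_zero, mul_eq_zero,
    ENNReal.rpow_eq_zero_iff_of_pos (sub_pos.2 hs), hx2, or_false] at h0
  refine ENNReal.tsum_eq_zero.2 fun i => ?_
  rcases h0 i with h | h
  · rw [h, zero_mul]
  · have := hx1 i
    rw [h, mul_zero, nonpos_iff_eq_zero] at this
    rw [this, zero_mul]

/-- Damping a weight by the negative power `W ^ (-β)` of its own potential turns its potential into at most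
a constant times `W ^ (1 - β (s - 1))`. The partial sums `P j` of `W` up to `j` are `ℱ_j`-measurable and
at most `W`, so that `E_j(W ^ (-β) w) ≤ (P j) ^ (-β) E_j(w)`. -/
lemma adaptedWolff_damped_le (hα : TailCondition ℱ μ α c) {v w : Ω → ℝ≥0∞}
    (hw : IsWeight ℱ μ w) {s β : ℝ} (hs : 1 < s) (hβ : 0 ≤ β) (hβs : β * (s - 1) < 1)
    (hv : ∀ x, v x ≤ adaptedWolff ℱ μ α s w x ^ (-β) * w x) :
    ∀ᵐ x ∂μ, adaptedWolff ℱ μ α s v x ≤ (ENNReal.ofReal (1 - β * (s - 1)))⁻¹ *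
      adaptedWolff ℱ μ α s w x ^ (1 - β * (s - 1)) := by
  have hs0 : 0 < s - 1 := by linarith
  set P : ℤ → Ω → ℝ≥0∞ := fun j x => ∑' n : ℕ, adaptedWolffTerm ℱ μ α s w (j - n) x with hP
  have hPm : ∀ j, Measurable[ℱ j] (P j) := fun j =>
    @Measurable.tsum Ω ℝ≥0∞ ℕ (ℱ j) _ _ _ _ _ _ _ _ _ _ _ _ fun n =>
    (hα.measurable_adaptedWolffTerm s w (j - n)).mono (ℱ.mono (by simp)) le_rfl
  have hPle : ∀ j x, P j x ≤ adaptedWolff ℱ μ α s w x := fun j x =>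
    ENNReal.tsum_comp_le_tsum_of_injective (fun a b h => by simpa using h)
      fun i => adaptedWolffTerm ℱ μ α s w i x
  have hE : ∀ᵐ x ∂μ, ∀ j, condLExp (ℱ j) μ v x ≤ P j x ^ (-β) * condLExp (ℱ j) μ w x := by
    refine ae_all_iff.2 fun j => ?_
    refine (condLExp_mono (ae_of_all _ fun x => ?_)).trans
      (condLExp_mul_left (ℱ.le j) ((hPm j).pow_const (-β)) hw.1).le
    exact (hv x).trans (mul_le_mul' (ENNReal.rpow_neg_anti (hPle j x) hβ) le_rfl)
  filter_upwards [hE] with x hx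
  refine le_trans (ENNReal.tsum_le_tsum fun j => ?_)
    (ENNReal.tsum_mul_partial_rpow_neg_le (fun i => adaptedWolffTerm ℱ μ α s w i x)
      (mul_nonneg hβ hs0.le) hβs)
  calc adaptedWolffTerm ℱ μ α s v j x
      ≤ α j x * adaptedTail ℱ μ α j x ^ (s - 1) *
          (P j x ^ (-β) * condLExp (ℱ j) μ w x) ^ (s - 1) := by
        rw [adaptedWolffTerm]
        gcongr
        exact hx j
    _ = _ := by
        rw [ENNReal.mul_rpow_of_nonneg _ _ hs0.le, ← ENNReal.rpow_mul, adaptedWolffTerm, neg_mul]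
        ring

/-- Sufficiency of the potential bound for all `0 < q < p`, with an auxiliary exponent `q₁ > max 1 q`.
Hölder's inequality reduces the exponent `q` for `w` to `q₁` for the damped weight `W ^ (-β) w`. -/
theorem lintegral_posOpENN_rpow_withDensity_le (hα : TailCondition ℱ μ α c) {w : Ω → ℝ≥0∞}
    (hw : IsWeight ℱ μ w) {s p : ℝ} (hs : s.HolderConjugate p) {q q₁ q₁' R R₁ R₁' β : ℝ}
    (hq : 0 < q) (hqq : q < q₁) (hq₁ : q₁.HolderConjugate q₁') (hR₁ : R₁.HolderConjugate R₁')
    (hRq : s * R₁' = q₁') (hR : 0 < R) (hβ : 0 ≤ β) (hβs : β * (s - 1) < 1)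
    (hβR₁ : (1 - β * (s - 1)) * R₁ - β = R) (hβR : β * q = R * (q₁ - q))
    (hI : ∫⁻ x, adaptedWolff ℱ μ α s w x ^ R ∂(μ.withDensity w) ≠ ∞)
    {f : Ω → ℝ≥0∞} (hf : Measurable f) :
    ∫⁻ x, posOpENN ℱ μ α f x ^ q ∂(μ.withDensity w) ≤
      (((∫⁻ x, f x ^ p ∂μ) ^ (1 / p) * (sumConst s * c ^ (s - 1) *
        (((ENNReal.ofReal (1 - β * (s - 1)))⁻¹ ^ R₁ *
          ∫⁻ x, adaptedWolff ℱ μ α s w x ^ R ∂(μ.withDensity w)) ^ (1 / R₁) *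
          (ENNReal.ofReal q₁ ^ q₁') ^ (1 / R₁'))) ^ (1 / s)) ^ q₁) ^ (q / q₁) *
      (∫⁻ x, adaptedWolff ℱ μ α s w x ^ R ∂(μ.withDensity w)) ^ (1 - q / q₁) := by
  set W := adaptedWolff ℱ μ α s w with hW
  have hWm : Measurable W := hα.measurable_adaptedWolff s w
  have hTm := hα.measurable_posOpENN f
  have hq₁0 : 0 < q₁ := hq₁.pos
  set γ := β * (s - 1) with hγ
  set I := ∫⁻ x, W x ^ R ∂(μ.withDensity w) with hIdef
  set K := (∫⁻ x, f x ^ p ∂μ) ^ (1 / p) * (sumConst s * c ^ (s - 1) *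
        (((ENNReal.ofReal (1 - γ))⁻¹ ^ R₁ * I) ^ (1 / R₁) *
          (ENNReal.ofReal q₁ ^ q₁') ^ (1 / R₁'))) ^ (1 / s) with hK
  -- the weight is damped where the potential is large, and truncated to stay a weight
  set v : ℕ → Ω → ℝ≥0∞ := fun n x => min (W x ^ (-β)) n * w x with hv
  have hdm : ∀ n : ℕ, Measurable fun x => min (W x ^ (-β)) (n : ℝ≥0∞) := fun n =>
    (hWm.pow_const _).min measurable_const
  have hvw : ∀ n, IsWeight ℱ μ (v n) := fun n =>
    hw.mono ((hdm n).fun_mul hw.1) (ENNReal.natCast_ne_top n) fun x =>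
      mul_le_mul' (min_le_right _ _) le_rfl
  have hwd : ∀ n (F : Ω → ℝ≥0∞), Measurable F → ∫⁻ x, F x ∂(μ.withDensity (v n)) =
      ∫⁻ x, F x * min (W x ^ (-β)) n ∂(μ.withDensity w) := fun n F hF => by
    rw [lintegral_withDensity_eq_lintegral_mul_right (hvw n).1 hF,
      lintegral_withDensity_eq_lintegral_mul_right hw.1 (hF.fun_mul (hdm n))]
    simp_rw [hv, mul_assoc]
  have hpot : ∀ n, ∫⁻ x, adaptedWolff ℱ μ α s (v n) x ^ R₁ ∂(μ.withDensity (v n)) ≤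
      (ENNReal.ofReal (1 - γ))⁻¹ ^ R₁ * I := fun n => by
    rw [hwd n _ ((hα.measurable_adaptedWolff s (v n)).pow_const _), hIdef,
      ← lintegral_const_mul _ (hWm.pow_const _)]
    refine lintegral_mono_ae ?_
    filter_upwards [(withDensity_absolutelyContinuous μ w).ae_le
      (hα.adaptedWolff_damped_le (v := v n) hw hs.lt hβ hβs
        fun x => mul_le_mul' (min_le_left _ _) le_rfl)] with x hx
    calc adaptedWolff ℱ μ α s (v n) x ^ R₁ * min (W x ^ (-β)) n
        ≤ ((ENNReal.ofReal (1 - γ))⁻¹ * W x ^ (1 - γ)) ^ R₁ * W x ^ (-β) := by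
          gcongr
          · exact hR₁.nonneg
          · exact min_le_left _ _
      _ = (ENNReal.ofReal (1 - γ))⁻¹ ^ R₁ * (W x ^ ((1 - γ) * R₁) * W x ^ (-β)) := by
          rw [ENNReal.mul_rpow_of_nonneg _ _ hR₁.nonneg, ← ENNReal.rpow_mul, mul_assoc]
      _ ≤ (ENNReal.ofReal (1 - γ))⁻¹ ^ R₁ * W x ^ R := by
          gcongr
          rcases eq_or_ne (W x) 0 with h0 | h0
          · rw [h0, ENNReal.zero_rpow_of_pos (mul_pos (by linarith) hR₁.pos), zero_mul]
            exact zero_le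
          rcases eq_or_ne (W x) ∞ with ht | ht
          · rw [ht, ENNReal.top_rpow_of_pos hR]
            exact le_top
          rw [← ENNReal.rpow_add _ _ h0 ht, ← hβR₁, ← sub_eq_add_neg]
  have htrunc : ∀ n : ℕ, ∫⁻ x, posOpENN ℱ μ α f x ^ q₁ * min (W x ^ (-β)) n ∂(μ.withDensity w) ≤
      K ^ q₁ := fun n => by
    rw [← hwd n _ (hTm.pow_const _)]
    refine (hα.lintegral_posOpENN_rpow_withDensity_le_of_one_lt (hvw n) hs hq₁ hR₁ hRq hf).trans ?_
    rw [hK]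
    gcongr
    · exact hs.one_div_nonneg
    · exact hR₁.one_div_nonneg
    · exact hpot n
  have hdamped : ∫⁻ x, posOpENN ℱ μ α f x ^ q₁ * W x ^ (-β) ∂(μ.withDensity w) ≤ K ^ q₁ :=
    lintegral_le_of_tendsto_of_le (fun n => (hTm.pow_const _).fun_mul (hdm n))
      (fun x => ENNReal.tendsto_mul_min_natCast _ _) htrunc
  have hWfin : ∀ᵐ x ∂(μ.withDensity w), W x ≠ ∞ := by
    filter_upwards [ae_lt_top (hWm.pow_const R) hI] with x hx h
    rw [h, ENNReal.top_rpow_of_pos hR] at hx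
    exact lt_irrefl _ hx
  have hqle : q / q₁ ≤ 1 := (div_le_one hq₁0).2 hqq.le
  calc ∫⁻ x, posOpENN ℱ μ α f x ^ q ∂(μ.withDensity w)
      ≤ ∫⁻ x, (posOpENN ℱ μ α f x ^ q₁ * W x ^ (-β)) ^ (q / q₁) * (W x ^ R) ^ (1 - q / q₁)
          ∂(μ.withDensity w) := by
        refine lintegral_mono_ae ?_
        filter_upwards [hWfin, hα.posOpENN_eq_zero_of_adaptedWolff_eq_zero w hs.lt f]
          with x hx hx0
        rcases eq_or_ne (W x) 0 with h0 | h0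
        · rw [hx0 h0, ENNReal.zero_rpow_of_pos hq]
          exact zero_le
        have e : -β * (q / q₁) + R * (1 - q / q₁) = 0 := by
          field_simp
          linarith
        rw [ENNReal.mul_rpow_of_nonneg _ _ (by positivity), ← ENNReal.rpow_mul,
          ← ENNReal.rpow_mul, ← ENNReal.rpow_mul, mul_div_cancel₀ _ hq₁0.ne', mul_assoc,
          ← ENNReal.rpow_add _ _ h0 hx, e, ENNReal.rpow_zero, mul_one]
    _ ≤ (∫⁻ x, posOpENN ℱ μ α f x ^ q₁ * W x ^ (-β) ∂(μ.withDensity w)) ^ (q / q₁) *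
          I ^ (1 - q / q₁) :=
        ENNReal.lintegral_mul_norm_pow_le
          ((hTm.pow_const _).fun_mul (hWm.pow_const _)).aemeasurable
          (hWm.pow_const _).aemeasurable (by positivity) (by linarith) (by ring)
    _ ≤ _ := by gcongr

end TailCondition

/-! ### Passage to the real-valued statements -/

universe u

/-- Sufficiency in terms of the given exponents: the auxiliary ones are
`β = (p - 1) (q₁ - q) / (p - q)` and `R₁ = q₁ (p - 1) / (p - q₁)` for some `q₁` between `max 1 q` and
`p`. -/
theorem exists_const_lintegral_posOpENN_rpow_le (p q r : ℝ) (c : ℝ≥0) (hp : 1 < p) (hq : 0 < q)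
    (hqp : q < p) (hr : 1 / r = 1 / q - 1 / p) :
    ∃ K : ℝ≥0∞, K ≠ ∞ ∧ ∀ (Ω : Type u) [m₀ : MeasurableSpace Ω] (μ : Measure Ω)
      (ℱ : Filtration ℤ m₀) [SigmaFiniteFiltration μ ℱ] (α : ℤ → Ω → ℝ≥0) (w : Ω → ℝ≥0∞),
      TailCondition ℱ μ α c → IsWeight ℱ μ w → ∀ f : Ω → ℝ≥0∞, Measurable f →
        ∫⁻ x, adaptedWolff ℱ μ α p.conjExponent w x ^ (r / p.conjExponent)
          ∂(μ.withDensity w) ≠ ∞ →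
        (∫⁻ x, posOpENN ℱ μ α f x ^ q ∂(μ.withDensity w)) ^ (1 / q) ≤
          K * (∫⁻ x, adaptedWolff ℱ μ α p.conjExponent w x ^ (r / p.conjExponent)
            ∂(μ.withDensity w)) ^ (1 / r) * (∫⁻ x, f x ^ p ∂μ) ^ (1 / p) := by
  have hp0 : 0 < p := by linarith
  have hs : (p.conjExponent).HolderConjugate p := (Real.HolderConjugate.conjExponent hp).symm
  set s := p.conjExponent with hsdef
  have hsp : s = p / (p - 1) := rfl
  have hp1 : 0 < p - 1 := by linarith
  have hpq : 0 < p - q := by linarith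
  have hr' : r = p * q / (p - q) := by
    rw [← one_div_one_div r, hr]
    field_simp
  -- an exponent `q₁` in `(max 1 q, p)`
  obtain ⟨q₁, hq₁l, hq₁p⟩ := exists_between (max_lt hp hqp)
  obtain ⟨hq₁1, hqq₁⟩ := max_lt_iff.1 hq₁l
  have hq₁0 : 0 < q₁ := by linarith
  have hq₁1' : 0 < q₁ - 1 := by linarith
  have hpq₁ : 0 < p - q₁ := by linarith
  have hqq₁' : 0 < q₁ - q := by linarith
  set q₁' := q₁ / (q₁ - 1) with hq₁'
  set R₁ := q₁ * (p - 1) / (p - q₁) with hR₁def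
  set R₁' := q₁' / s with hR₁'def
  set β := (p - 1) * (q₁ - q) / (p - q) with hβdef
  have hq₁c : q₁.HolderConjugate q₁' := (Real.holderConjugate_iff_eq_conjExponent hq₁1).2 rfl
  have hs1 : s - 1 = 1 / (p - 1) := by rw [hsp]; field_simp; ring
  have hR : r / s = q * (p - 1) / (p - q) := by rw [hr', hsp]; field_simp
  have hR₁c : R₁.HolderConjugate R₁' := by
    refine Real.holderConjugate_iff.2 ⟨?_, ?_⟩
    · rw [hR₁def, lt_div_iff₀ hpq₁]; nlinarith
    · rw [hR₁def, hR₁'def, hsp, hq₁']; field_simp; ring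
  have hβs : β * (s - 1) = (q₁ - q) / (p - q) := by rw [hs1, hβdef]; field_simp
  have hβs1 : β * (s - 1) < 1 := by rw [hβs, div_lt_one hpq]; linarith
  refine ⟨(sumConst s * c ^ (s - 1) * ((ENNReal.ofReal (1 - β * (s - 1)))⁻¹ *
    (ENNReal.ofReal q₁ ^ q₁') ^ (1 / R₁'))) ^ (1 / s), ?_, ?_⟩
  · refine ENNReal.rpow_ne_top_of_nonneg hs.one_div_nonneg (ENNReal.mul_ne_top
      (ENNReal.mul_ne_top (sumConst_ne_top hs.lt) (ENNReal.rpow_ne_top_of_nonneg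
        hs.sub_one_pos.le ENNReal.coe_ne_top)) (ENNReal.mul_ne_top ?_
        (ENNReal.rpow_ne_top_of_nonneg hR₁c.symm.one_div_nonneg
          (ENNReal.rpow_ne_top_of_nonneg hq₁c.symm.nonneg ENNReal.ofReal_ne_top))))
    rw [ENNReal.inv_ne_top, Ne, ENNReal.ofReal_eq_zero, not_le]
    linarith
  intro Ω m₀ μ ℱ _ α w hα hw f hf hI
  have key := hα.lintegral_posOpENN_rpow_withDensity_le hw hs hq hqq₁ hq₁c hR₁c
    (R := r / s) (β := β) (by rw [hR₁'def]; field_simp [hs.ne_zero])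
    (by rw [hR]; positivity) (by positivity) hβs1
    (by rw [hβs, hR, hβdef, hR₁def]; field_simp; ring) (by rw [hR, hβdef]; field_simp) hI hf
  set I := ∫⁻ x, adaptedWolff ℱ μ α s w x ^ (r / s) ∂(μ.withDensity w)
  set F := (∫⁻ x, f x ^ p ∂μ) ^ (1 / p)
  refine (ENNReal.rpow_le_rpow key (by positivity : 0 ≤ 1 / q)).trans (le_of_eq ?_)
  have hs0 := hs.one_div_nonneg
  have e1 : q₁ * (q / q₁ * (1 / q)) = 1 := by field_simp
  have e2 : R₁ * (1 / R₁) = 1 := mul_one_div_cancel hR₁c.ne_zero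
  have e3 : 1 / R₁ * (1 / s) + (1 - q / q₁) * (1 / q) = 1 / r := by
    rw [hr, hR₁def, hsp]; field_simp; ring
  have n1 : 0 ≤ 1 / R₁ * (1 / s) := mul_nonneg hR₁c.one_div_nonneg hs0
  have n2 : 0 ≤ (1 - q / q₁) * (1 / q) := by
    have : q / q₁ ≤ 1 := (div_le_one hq₁0).2 hqq₁.le
    have : 0 ≤ 1 - q / q₁ := by linarith
    positivity
  rw [ENNReal.mul_rpow_of_nonneg _ _ (by positivity : 0 ≤ 1 / q), ← ENNReal.rpow_mul,
    ← ENNReal.rpow_mul, e1, ENNReal.rpow_one, ← ENNReal.rpow_mul I,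
    ENNReal.mul_rpow_of_nonneg _ I hR₁c.one_div_nonneg, ← ENNReal.rpow_mul _ R₁, e2,
    ENNReal.rpow_one, ← e3, ENNReal.rpow_add_of_nonneg _ _ n1 n2, ENNReal.rpow_mul I (1 / R₁)]
  simp only [ENNReal.mul_rpow_of_nonneg _ _ hs0]
  ring

section transfer

variable {Ω : Type*} {m₀ : MeasurableSpace Ω} {μ : Measure Ω} {ℱ : Filtration ℤ m₀}
  {α : ℤ → Ω → ℝ≥0} {c : ℝ≥0} {w : Ω → ℝ≥0∞}

lemma eLpNorm_ofReal_eq {ε : Type*} [ENorm ε] {p : ℝ} (hp : 0 < p) (f : Ω → ε) (ν : Measure Ω) :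
    eLpNorm f (ENNReal.ofReal p) ν = (∫⁻ x, ‖f x‖ₑ ^ p ∂ν) ^ (1 / p) := by
  rw [eLpNorm_eq_lintegral_rpow_enorm_toReal (by simpa using hp) ENNReal.ofReal_ne_top,
    ENNReal.toReal_ofReal hp.le]

lemma eLpNorm_wolffPotential {p r : ℝ} (hr : 0 < r) :
    eLpNorm (fun x => wolffPotential ℱ μ α w p x ^ (1 / p.conjExponent)) (ENNReal.ofReal r)
      (μ.withDensity w) =
      (∫⁻ x, wolffPotential ℱ μ α w p x ^ (r / p.conjExponent) ∂(μ.withDensity w)) ^ (1 / r) := by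
  rw [eLpNorm_ofReal_eq hr]
  simp_rw [enorm_eq_self, ← ENNReal.rpow_mul, one_div_mul_eq_div]

lemma TailCondition.adaptedWolff_le (hα : TailCondition ℱ μ α c) {p : ℝ} (hp : 1 < p) :
    ∀ᵐ x ∂(μ.withDensity w), adaptedWolff ℱ μ α p.conjExponent w x ≤
      c ^ (p.conjExponent - 1) * wolffPotential ℱ μ α w p x := by
  have hs := (Real.HolderConjugate.conjExponent hp).symm.sub_one_pos.le
  filter_upwards [(withDensity_absolutelyContinuous μ w).ae_le (ae_all_iff.2 hα.condExp_le)]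
    with x hx
  rw [adaptedWolff, wolffPotential, ← ENNReal.tsum_mul_left]
  refine ENNReal.tsum_le_tsum fun i => ?_
  calc adaptedWolffTerm ℱ μ α p.conjExponent w i x
      ≤ α i x * (c * tailSum α i x) ^ (p.conjExponent - 1) *
          condLExp (ℱ i) μ w x ^ (p.conjExponent - 1) := by
        rw [adaptedWolffTerm]
        gcongr
        exact hx i
    _ = _ := by rw [ENNReal.mul_rpow_of_nonneg _ _ hs]; ring

lemma TailCondition.wolffPotential_le (hα : TailCondition ℱ μ α c) {p : ℝ} (hp : 1 < p) :
    ∀ᵐ x ∂(μ.withDensity w), wolffPotential ℱ μ α w p x ≤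
      c ^ (p.conjExponent - 1) * adaptedWolff ℱ μ α p.conjExponent w x := by
  have hs := (Real.HolderConjugate.conjExponent hp).symm.sub_one_pos.le
  filter_upwards [(withDensity_absolutelyContinuous μ w).ae_le (ae_all_iff.2 hα.le_condExp)]
    with x hx
  rw [adaptedWolff, wolffPotential, ← ENNReal.tsum_mul_left]
  refine ENNReal.tsum_le_tsum fun i => ?_
  calc (α i x : ℝ≥0∞) * tailSum α i x ^ (p.conjExponent - 1) *
        condLExp (ℱ i) μ w x ^ (p.conjExponent - 1)
      ≤ α i x * (c * adaptedTail ℱ μ α i x) ^ (p.conjExponent - 1) *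
          condLExp (ℱ i) μ w x ^ (p.conjExponent - 1) := by
        gcongr
        exact hx i
    _ = _ := by rw [ENNReal.mul_rpow_of_nonneg _ _ hs, adaptedWolffTerm]; ring

lemma enorm_toReal_sub_toReal_le {a b d : ℝ≥0∞} (ha : a ≤ d) (hb : b ≤ d) :
    ‖a.toReal - b.toReal‖ₑ ≤ d := by
  rcases eq_or_ne d ∞ with rfl | hd
  · exact le_top
  rw [Real.enorm_eq_ofReal_abs, ← ENNReal.ofReal_toReal hd]
  refine ENNReal.ofReal_le_ofReal (abs_sub_le_iff.2 ⟨?_, ?_⟩)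
  · have := ENNReal.toReal_mono hd ha
    have := b.toReal_nonneg
    linarith
  · have := ENNReal.toReal_mono hd hb
    have := a.toReal_nonneg
    linarith

lemma enorm_condExpLoc_le (m : MeasurableSpace Ω) {f : Ω → ℝ} {F : Ω → ℝ≥0∞}
    (hF : ∀ᵐ x ∂μ, ‖f x‖ₑ = F x) :
    ∀ᵐ x ∂μ, ‖condExpLoc m μ f x‖ₑ ≤ condLExp m μ F x := by
  have h1 : condLExp m μ (fun y => ENNReal.ofReal (f y)) ≤ᵐ[μ] condLExp m μ F :=
    condLExp_mono (hF.mono fun x hx => by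
      dsimp only
      rw [← hx, Real.enorm_eq_ofReal_abs]
      exact ENNReal.ofReal_le_ofReal (le_abs_self _))
  have h2 : condLExp m μ (fun y => ENNReal.ofReal (-f y)) ≤ᵐ[μ] condLExp m μ F :=
    condLExp_mono (hF.mono fun x hx => by
      dsimp only
      rw [← hx, Real.enorm_eq_ofReal_abs]
      exact ENNReal.ofReal_le_ofReal (neg_le_abs _))
  filter_upwards [h1, h2] with x hx1 hx2 using enorm_toReal_sub_toReal_le hx1 hx2

lemma condExpLoc_toReal (m : MeasurableSpace Ω) {f : Ω → ℝ≥0∞} (hf : ∀ᵐ x ∂μ, f x ≠ ∞) :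
    ∀ᵐ x ∂μ, condExpLoc m μ (fun y => (f y).toReal) x = (condLExp m μ f x).toReal := by
  have h1 : condLExp m μ (fun y => ENNReal.ofReal (f y).toReal) =ᵐ[μ] condLExp m μ f :=
    condLExp_congr_ae (hf.mono fun x hx => ENNReal.ofReal_toReal hx)
  have h2 : condLExp m μ (fun y => ENNReal.ofReal (-(f y).toReal)) = 0 := by
    have : (fun y => ENNReal.ofReal (-(f y).toReal)) = 0 := by
      ext y
      simp
    rw [this, condLExp_zero]
  filter_upwards [h1] with x hx
  rw [condExpLoc, hx, h2]
  simp

/-- A bound for `T_α` on functions with values in `ℝ≥0∞` implies the trace inequality. It yields the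
absolute convergence of the series for a real function `f` by comparison with `T_α |f|`. -/
theorem traceInequality_of_posOpENN {p q : ℝ} (hp : 0 < p) (hq : 0 < q) {C : ℝ≥0}
    (hα : TailCondition ℱ μ α c)
    (h : ∀ f : Ω → ℝ≥0∞, Measurable f →
      (∫⁻ x, posOpENN ℱ μ α f x ^ q ∂(μ.withDensity w)) ^ (1 / q) ≤
        C * (∫⁻ x, f x ^ p ∂μ) ^ (1 / p)) :
    TraceInequality ℱ μ α w p q C := by
  intro f hf
  have hfm := hf.1.enorm
  set F := hfm.mk _ with hFdef
  have hFm : Measurable F := hfm.measurable_mk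
  have hFf : ∀ᵐ x ∂μ, ‖f x‖ₑ = F x := hfm.ae_eq_mk
  have hnorm : eLpNorm f (ENNReal.ofReal p) μ = (∫⁻ x, F x ^ p ∂μ) ^ (1 / p) := by
    rw [eLpNorm_ofReal_eq hp]
    congr 1
    exact lintegral_congr_ae (hFf.mono fun x hx => by dsimp only; rw [hx])
  have hterm : ∀ᵐ x ∂(μ.withDensity w), ∀ i,
      ‖(α i x : ℝ) * condExpLoc (ℱ i) μ f x‖ₑ ≤ α i x * condLExp (ℱ i) μ F x := by
    refine ae_all_iff.2 fun i => (withDensity_absolutelyContinuous μ w).ae_le ?_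
    filter_upwards [enorm_condExpLoc_le (ℱ i) hFf] with x hx
    rw [enorm_mul]
    gcongr
    simp [Real.enorm_eq_ofReal_abs]
  have hbound := h F hFm
  rw [← hnorm] at hbound
  have hfin : ∀ᵐ x ∂(μ.withDensity w), posOpENN ℱ μ α F x ≠ ∞ := by
    have hlt : ∫⁻ x, posOpENN ℱ μ α F x ^ q ∂(μ.withDensity w) ≠ ∞ := by
      intro htop
      rw [htop, ENNReal.top_rpow_of_pos (by positivity)] at hbound
      exact (ENNReal.mul_lt_top ENNReal.coe_lt_top hf.2).not_ge hbound
    filter_upwards [ae_lt_top ((hα.measurable_posOpENN F).pow_const q) hlt] with x hx htop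
    rw [htop, ENNReal.top_rpow_of_pos hq] at hx
    exact lt_irrefl _ hx
  refine ⟨?_, ?_⟩
  · filter_upwards [hterm, hfin] with x hx hxfin
    exact Summable.of_enorm (ne_top_of_le_ne_top hxfin (ENNReal.tsum_le_tsum hx))
  · refine le_trans ?_ hbound
    rw [eLpNorm_ofReal_eq hq]
    refine ENNReal.rpow_le_rpow (lintegral_mono_ae ?_) (by positivity)
    filter_upwards [hterm] with x hx
    exact ENNReal.rpow_le_rpow (enorm_tsum_le_tsum_enorm.trans (ENNReal.tsum_le_tsum hx)) hq.le

/-- The trace inequality extends to functions with values in `ℝ≥0∞` that have finite `L^p` norm. Such a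
function has finite conditional expectations, so that no junk value enters. -/
theorem TraceInequality.lintegral_posOpENN_rpow_le [SigmaFiniteFiltration μ ℱ] {p q : ℝ}
    (hp : 1 < p) (hq : 0 < q) {C : ℝ≥0} (h : TraceInequality ℱ μ α w p q C) {f : Ω → ℝ≥0∞}
    (hf : Measurable f) (hfp : ∫⁻ x, f x ^ p ∂μ ≠ ∞) :
    (∫⁻ x, posOpENN ℱ μ α f x ^ q ∂(μ.withDensity w)) ^ (1 / q) ≤
      C * (∫⁻ x, f x ^ p ∂μ) ^ (1 / p) := by
  have hp0 : 0 < p := by linarith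
  have hffin : ∀ᵐ x ∂μ, f x ≠ ∞ := by
    filter_upwards [ae_lt_top (hf.pow_const p) hfp] with x hx htop
    rw [htop, ENNReal.top_rpow_of_pos hp0] at hx
    exact lt_irrefl _ hx
  have hnorm : eLpNorm (fun x => (f x).toReal) (ENNReal.ofReal p) μ =
      (∫⁻ x, f x ^ p ∂μ) ^ (1 / p) := by
    rw [eLpNorm_ofReal_eq hp0]
    congr 1
    refine lintegral_congr_ae (hffin.mono fun x hx => ?_)
    dsimp only
    rw [Real.enorm_of_nonneg ENNReal.toReal_nonneg, ENNReal.ofReal_toReal hx]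
  obtain ⟨hsum, hle⟩ := h (fun x => (f x).toReal) ⟨hf.ennreal_toReal.aestronglyMeasurable, by
    rw [hnorm]
    exact ENNReal.rpow_lt_top_of_nonneg (by positivity) hfp⟩
  rw [hnorm, eLpNorm_ofReal_eq hq] at hle
  have hEfin : ∀ i, ∀ᵐ x ∂μ, condLExp (ℱ i) μ f x < ∞ := fun i =>
    condLExp_lt_top_of_forall_setLIntegral (ℱ.le i) fun E _ hμE => by
      calc ∫⁻ x in E, f x ∂μ ≤ ∫⁻ x in E, 1 + f x ^ p ∂μ := by
            refine lintegral_mono fun x => ?_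
            rcases le_total (f x) 1 with h1 | h1
            · exact le_add_right h1
            · refine le_add_left ?_
              calc f x = f x ^ (1 : ℝ) := (ENNReal.rpow_one _).symm
                _ ≤ f x ^ p := ENNReal.rpow_le_rpow_of_exponent_le h1 hp.le
        _ ≤ μ E + ∫⁻ x, f x ^ p ∂μ := by
            rw [lintegral_add_left measurable_const, setLIntegral_const, one_mul]
            gcongr
            exact Measure.restrict_le_self
        _ < ∞ := ENNReal.add_lt_top.2 ⟨hμE, hfp.lt_top⟩
  refine le_trans (ENNReal.rpow_le_rpow (lintegral_mono_ae ?_) (by positivity)) hle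
  have hall : ∀ᵐ x ∂(μ.withDensity w), ∀ i,
      ENNReal.ofReal ((α i x : ℝ) * condExpLoc (ℱ i) μ (fun y => (f y).toReal) x) =
        α i x * condLExp (ℱ i) μ f x ∧
      0 ≤ (α i x : ℝ) * condExpLoc (ℱ i) μ (fun y => (f y).toReal) x := by
    refine ae_all_iff.2 fun i => (withDensity_absolutelyContinuous μ w).ae_le ?_
    filter_upwards [condExpLoc_toReal (ℱ i) hffin, hEfin i] with x hx hxfin
    rw [hx]
    refine ⟨?_, by positivity⟩
    rw [ENNReal.ofReal_mul (by positivity), ENNReal.ofReal_toReal hxfin.ne,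
      ENNReal.ofReal_coe_nnreal]
  filter_upwards [hall, hsum] with x hx hxs
  refine ENNReal.rpow_le_rpow (le_of_eq ?_) hq.le
  rw [posOp, Real.enorm_of_nonneg (tsum_nonneg fun i => (hx i).2),
    ENNReal.ofReal_tsum_of_nonneg (fun i => (hx i).2) hxs, posOpENN]
  exact tsum_congr fun i => (hx i).1.symm

end transfer

theorem theorem1p2 (p q r : ℝ) (c : ℝ≥0) (hp : 1 < p) (hq : 0 < q) (hqp : q < p)
    (hr : 1 / r = 1 / q - 1 / p) :
    ∃ C : ℝ≥0, 0 < C ∧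
      ∀ (Ω : Type*) [m₀ : MeasurableSpace Ω] (μ : Measure Ω) (ℱ : Filtration ℤ m₀)
        [SigmaFiniteFiltration μ ℱ] (α : ℤ → Ω → ℝ≥0) (w : Ω → ℝ≥0∞),
        TailCondition ℱ μ α c → IsWeight ℱ μ w →
          (∀ C₂ : ℝ≥0, WolffBound ℱ μ α w p r C₂ → TraceInequality ℱ μ α w p q (C * C₂)) ∧
          (1 < q → ∀ C₁ : ℝ≥0, TraceInequality ℱ μ α w p q C₁ →
            WolffBound ℱ μ α w p r (C * C₁)) := by
  have hp0 : 0 < p := by linarith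
  have hs : (p.conjExponent).HolderConjugate p := (Real.HolderConjugate.conjExponent hp).symm
  have hr0 : 0 < r := by
    rw [← one_div_pos, hr, sub_pos]
    exact one_div_lt_one_div_of_lt hq hqp
  obtain ⟨K, hK, hKle⟩ := exists_const_lintegral_posOpENN_rpow_le p q r c hp hq hqp hr
  set s := p.conjExponent with hsdef
  have hsp : s = p / (p - 1) := rfl
  have hp1 : 0 < p - 1 := by linarith
  have hpq : 0 < p - q := by linarith
  set R := r / s with hR
  have hR0 : 0 < R := div_pos hr0 hs.pos
  have hRr : R * (1 / r) = 1 / s := by rw [hR]; field_simp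
  set κ : ℝ≥0∞ := ((c : ℝ≥0∞) ^ (s - 1)) ^ (1 / s) with hκ
  have hκtop : κ ≠ ∞ := ENNReal.rpow_ne_top_of_nonneg hs.one_div_nonneg
    (ENNReal.rpow_ne_top_of_nonneg hs.sub_one_pos.le ENNReal.coe_ne_top)
  set L : ℝ≥0∞ := ((ENNReal.ofReal p ^ s * c ^ s + 1) * ENNReal.ofReal R) ^ (1 / s) with hL
  have hLtop : L ≠ ∞ := ENNReal.rpow_ne_top_of_nonneg hs.one_div_nonneg
    (ENNReal.mul_ne_top (ENNReal.add_ne_top.2 ⟨ENNReal.mul_ne_top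
      (ENNReal.rpow_ne_top_of_nonneg hs.nonneg ENNReal.ofReal_ne_top)
      (ENNReal.rpow_ne_top_of_nonneg hs.nonneg ENNReal.coe_ne_top), ENNReal.one_ne_top⟩)
      ENNReal.ofReal_ne_top)
  have hCtop : κ * K + κ * L + 1 ≠ ∞ := by finiteness
  -- two potentials that are comparable with constant `c ^ (s - 1)` have comparable norms
  have compare : ∀ {Ω : Type _} [MeasurableSpace Ω] (ν : Measure Ω) (U V : Ω → ℝ≥0∞),
      (∀ᵐ x ∂ν, U x ≤ c ^ (s - 1) * V x) →
      (∫⁻ x, U x ^ R ∂ν) ^ (1 / r) ≤ κ * (∫⁻ x, V x ^ R ∂ν) ^ (1 / r) := by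
    intro Ω _ ν U V hUV
    have hc : ((c : ℝ≥0∞) ^ (s - 1)) ^ R ≠ ∞ := ENNReal.rpow_ne_top_of_nonneg hR0.le
      (ENNReal.rpow_ne_top_of_nonneg hs.sub_one_pos.le ENNReal.coe_ne_top)
    calc (∫⁻ x, U x ^ R ∂ν) ^ (1 / r)
        ≤ (∫⁻ x, ((c : ℝ≥0∞) ^ (s - 1)) ^ R * V x ^ R ∂ν) ^ (1 / r) := by
          refine ENNReal.rpow_le_rpow (lintegral_mono_ae ?_) (by positivity)
          filter_upwards [hUV] with x hx
          rw [← ENNReal.mul_rpow_of_nonneg _ _ hR0.le]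
          exact ENNReal.rpow_le_rpow hx hR0.le
      _ = _ := by
          rw [lintegral_const_mul' _ _ hc, ENNReal.mul_rpow_of_nonneg _ _ (by positivity),
            ← ENNReal.rpow_mul _ R, hRr]
  -- `K` serves sufficiency, `L` necessity, and the summand `1` only makes the constant positive
  refine ⟨(κ * K + κ * L + 1).toNNReal, ?_, ?_⟩
  · rw [ENNReal.toNNReal_pos_iff]
    exact ⟨by positivity, hCtop.lt_top⟩
  intro Ω m₀ μ ℱ _ α w hα hw
  refine ⟨fun C₂ hC₂ => ?_, fun hq1 C₁ hC₁ => ?_⟩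
  · rw [WolffBound, eLpNorm_wolffPotential hr0] at hC₂
    have hI := (compare (μ.withDensity w) _ _ (hα.adaptedWolff_le (w := w) hp)).trans
      (mul_le_mul' le_rfl hC₂)
    refine traceInequality_of_posOpENN hp0 hq hα fun f hf => ?_
    refine (hKle Ω μ ℱ α w hα hw f hf fun htop => ?_).trans ?_
    · rw [htop, ENNReal.top_rpow_of_pos (by positivity)] at hI
      exact (ENNReal.mul_lt_top hκtop.lt_top ENNReal.coe_lt_top).not_ge hI
    · refine mul_le_mul' ?_ le_rfl
      rw [ENNReal.coe_mul, ENNReal.coe_toNNReal hCtop]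
      calc K * _ ≤ K * (κ * C₂) := mul_le_mul' le_rfl hI
        _ = κ * K * C₂ := by ring
        _ ≤ _ := by
          gcongr
          rw [add_assoc]
          exact le_self_add
  · have hq1' : 0 < q - 1 := by linarith
    have hqc : q.HolderConjugate (q / (q - 1)) :=
      (Real.holderConjugate_iff_eq_conjExponent hq1).2 rfl
    have hr' : r = p * q / (p - q) := by
      rw [← one_div_one_div r, hr]
      field_simp
    have hRc : R.HolderConjugate (q / (q - 1) / s) := by
      refine Real.holderConjugate_iff.2 ⟨?_, ?_⟩
      · rw [hR, hr', hsp, div_div_div_eq, lt_div_iff₀ (by positivity)]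
        nlinarith [mul_pos hp0 hp1]
      · rw [hR, hr', hsp]; field_simp; ring
    have key := hα.lintegral_adaptedWolff_rpow_le hw hs hqc hRc (mul_div_cancel₀ _ hs.ne_zero)
      (C₁ := C₁) fun f hf hfp => hC₁.lintegral_posOpENN_rpow_le hp hq hf hfp
    rw [WolffBound, eLpNorm_wolffPotential hr0]
    refine (compare (μ.withDensity w) _ _ (hα.wolffPotential_le (w := w) hp)).trans ?_
    rw [ENNReal.coe_mul, ENNReal.coe_toNNReal hCtop]
    calc κ * (∫⁻ x, adaptedWolff ℱ μ α s w x ^ R ∂(μ.withDensity w)) ^ (1 / r)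
        ≤ κ * (((ENNReal.ofReal p ^ s * c ^ s + 1) * C₁ ^ s * ENNReal.ofReal R) ^ R) ^ (1 / r) := by
          gcongr
      _ = κ * L * C₁ := by
          rw [← ENNReal.rpow_mul, hRr, hL, mul_right_comm,
            ENNReal.mul_rpow_of_nonneg _ (_ ^ s) hs.one_div_nonneg, ← ENNReal.rpow_mul _ s,
            mul_one_div_cancel hs.ne_zero, ENNReal.rpow_one, mul_assoc]
      _ ≤ _ := by
          gcongr
          exact le_add_right le_add_self
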